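/- **Proposition 1.13.** Let $k\ge 1$, let $a=(a_1,\dots,a_k)$ be positive integers with $\gcd(a_1,\dots,a_k)=1$, let $r=(r_1,\dots,r_k)$ be positive integers, and put $|r|=r_1+\cdots+r_k$. Let $$P=P(a_1^{[r_1]},\dots,a_k^{[r_k]})=\big(\mathbb C^{r_1}\times\cdots\times\mathbb C^{r_k}\smallsetminus\{0\}\big)/\mathbb C^*,\qquad \lambda\cdot z=(\lambda^{a_1}z_1,\dots,\lambda^{a_k}z_k),$$ be the weighted projective space of dimension $|r|-1$, with projection $\pi$. For real $p>0$ let $\omega_{a,r,p}$ be the degenerate Kähler form on $P$ (smooth where all $z_s\neq 0$) defined by $$\pi^*\omega_{a,r,p}=dd^c\varphi_{a,r,p},\qquad \varphi_{a,r,p}(z)=\frac1p\log\sum_{1\le s\le k}|z_s|^{2p/a_s},$$ where $d^c=\frac{i}{4\pi}(\overline\partial-\partial)$, so that $dd^c=\frac{i}{2\pi}\partial\overline\partial$, and $|z_s|$ is the standard hermitian norm on $\mathbb C^{r_s}$. Let $f:P\to\mathbb C$ be a bounded function which is continuous outside of the sections $\{z_s=0\}$, $1\le s\le k$; we also view $f$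 as a $\mathbb C^*$-invariant function of $z\in\mathbb C^{r_1}\times\cdots\times\mathbb C^{r_k}\smallsetminus\{0\}$. Then for every real $p>0$ the integrals below converge absolutely and $$\int_{P}f\,\omega_{a,r,p}^{|r|-1}=\frac{(|r|-1)!}{\prod_s a_s^{r_s}}\int_{(x,u)\in\Delta_{k-1}\times\prod_s S^{2r_s-1}}f\big(x_1^{a_1/2p}u_1,\dots,x_k^{a_k/2p}u_k\big)\prod_{1\le s\le k}\frac{x_s^{r_s-1}}{(r_s-1)!}\,dx\,d\mu(u),$$ where $\Delta_{k-1}=\{x\in\mathbb R^k: x_s\ge 0,\ \sum_s x_s=1\}$, $dx=dx_1\cdots dx_{k-1}$, and $\mu=\mu_1\otimes\cdots\otimes\mu_k$ is the product of the rotation invariant probability measures $\mu_s$ on the unit spheres $S^{2r_s-1}\subset\mathbb C^{r_s}$. As a consequence $$\lim_{p\to+\infty}\int_{P}f\,\omega_{a,r,p}^{|r|-1}=\frac1{\prod_s a_s^{r_s}}\int_{\prod_s S^{2r_s-1}}f(u)\,d\mu(u).$$ -/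

import Mathlib

open MeasureTheory Filter Topology

noncomputable section

namespace WPS

/-! ### The operator `dd^c` and top exterior powers of 2-forms -/

section Forms

variable {E : Type*} [NormedAddCommGroup E] [NormedSpace ℂ E]

/-- The real 1-form `d^c u = (i/4π)(∂̄u - ∂u)` of a real-valued function `u` on a complex vector
space. As `∂u(v) = (du(v) - i du(iv))/2` and `∂̄u(v) = (du(v) + i du(iv))/2`, it is given by
`d^c u(v) = -(1/4π) du(iv)`. -/
def dc (u : E → ℝ) (z : E) : E [⋀^Fin 1]→L[ℝ] ℝ :=
  ContinuousAlternatingMap.ofSubsingleton ℝ E ℝ (0 : Fin 1)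
    ((-(1 / (4 * Real.pi))) •
      (fderiv ℝ u z).comp ((Complex.I • ContinuousLinearMap.id ℂ E).restrictScalars ℝ))

/-- The real 2-form `dd^c u = (i/2π) ∂∂̄u`: the exterior derivative of `d^c u`. -/
def ddc (u : E → ℝ) (z : E) : E [⋀^Fin 2]→L[ℝ] ℝ :=
  extDeriv (dc u) z

/-- The value on `v` of the exterior power `η^d = η ∧ ⋯ ∧ η` (`d = |J|` factors) of a 2-form `η`.
The `2d` arguments of the `2d`-form are indexed by `J × Fin 2`; as the blocks have even length,
the order of the blocks is irrelevant. -/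
def wedgePow {V : Type*} [NormedAddCommGroup V] [NormedSpace ℝ V]
    {J : Type*} [Fintype J] [DecidableEq J] (η : V [⋀^Fin 2]→L[ℝ] ℝ) (v : J × Fin 2 → V) : ℝ :=
  (1 / 2 ^ Fintype.card J) *
    ∑ σ : Equiv.Perm (J × Fin 2), ((Equiv.Perm.sign σ : ℤ) : ℝ) *
      ∏ j : J, η ![v (σ (j, 0)), v (σ (j, 1))]

/-- The real basis `(e_j, i e_j)_j` of `ℂ^J`; it is dual to the real coordinates `(x_j, y_j)_j` of
`w_j = x_j + i y_j` and positively oriented for the orientation of `ℂ^J` as a complex space. -/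
def stdFrame (J : Type*) [DecidableEq J] (b : J × Fin 2) : J → ℂ :=
  Pi.single b.1 (![1, Complex.I] b.2)

end Forms

/-! ### The weighted projective space -/

/-- `ℂ^{|r|} = ℂ^{r_1} × ⋯ × ℂ^{r_k}`, each factor with its standard hermitian norm; `k = m + 1`. -/
abbrev Cone {m : ℕ} (r : Fin (m + 1) → ℕ) : Type :=
  (s : Fin (m + 1)) → EuclideanSpace ℂ (Fin (r s))

/-- The weighted action `t · z = (t^{a_1} z_1, …, t^{a_k} z_k)`. -/
def act {m : ℕ} (a r : Fin (m + 1) → ℕ) (t : ℂ) (z : Cone r) : Cone r :=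
  fun s => t ^ a s • z s

/-- Two nonzero points are equivalent when they are in the same orbit of `ℂ^*`. -/
def orbitSetoid {m : ℕ} (a r : Fin (m + 1) → ℕ) : Setoid {z : Cone r // z ≠ 0} where
  r z w := ∃ t : ℂ, t ≠ 0 ∧ w.1 = act a r t z.1
  iseqv :=
    { refl := fun z => ⟨1, one_ne_zero, by funext s; simp [act]⟩
      symm := by
        rintro z w ⟨t, ht, h⟩
        refine ⟨t⁻¹, inv_ne_zero ht, ?_⟩
        funext s
        rw [h]
        simp [act, smul_smul, ht]
      trans := by
        rintro x y z ⟨t, ht, h⟩ ⟨t', ht', h'⟩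
        refine ⟨t' * t, mul_ne_zero ht' ht, ?_⟩
        funext s
        rw [h', h]
        simp [act, smul_smul, mul_pow] }

/-- The weighted projective space `P(a_1^{[r_1]}, …, a_k^{[r_k]}) = (ℂ^{|r|} ∖ {0}) / ℂ^*`. -/
def P {m : ℕ} (a r : Fin (m + 1) → ℕ) : Type :=
  Quotient (orbitSetoid a r)

/-- The quotient topology. -/
instance {m : ℕ} (a r : Fin (m + 1) → ℕ) : TopologicalSpace (P a r) :=
  inferInstanceAs (TopologicalSpace (Quotient (orbitSetoid a r)))

/-- The projection `π : ℂ^{|r|} ∖ {0} → P`. -/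
def proj {m : ℕ} (a r : Fin (m + 1) → ℕ) (z : {z : Cone r // z ≠ 0}) : P a r :=
  Quotient.mk (orbitSetoid a r) z

/-- The linear section `z_s = 0` of `P`. -/
def hyperplaneSection {m : ℕ} (a r : Fin (m + 1) → ℕ) (s : Fin (m + 1)) : Set (P a r) :=
  proj a r '' {z | z.1 s = 0}

open Classical in
/-- The function `f` on `P`, viewed as a `ℂ^*`-invariant function on `ℂ^{|r|} ∖ {0}`
(and put equal to `0` at the origin, where it has no meaning). -/
def coneFun {m : ℕ} {a r : Fin (m + 1) → ℕ} (f : P a r → ℂ) (z : Cone r) : ℂ :=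
  if h : z ≠ 0 then f (proj a r ⟨z, h⟩) else 0

/-! ### Integration over the weighted projective space -/

/-- The set of the `|r|` scalar coordinates of `ℂ^{|r|}`. -/
abbrev Coord {m : ℕ} (r : Fin (m + 1) → ℕ) : Type :=
  Σ s : Fin (m + 1), Fin (r s)

/-- The coordinates other than the `i`-th; there are `|r| - 1` of them. -/
abbrev Coord.Rest {m : ℕ} {r : Fin (m + 1) → ℕ} (i : Coord r) : Type :=
  {j : Coord r // j ≠ i}

/-- `|r| - 1` is the complex dimension of `P`. -/
theorem card_rest {m : ℕ} {r : Fin (m + 1) → ℕ} (i : Coord r) :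
    Fintype.card i.Rest = (∑ s, r s) - 1 := by
  simp [Coord.Rest, Fintype.card_subtype_compl]

/-- The affine slice `{z_i = 1}`, parametrized by the other coordinates `w ∈ ℂ^{|r|-1}`. -/
def slice {m : ℕ} {r : Fin (m + 1) → ℕ} (i : Coord r) (w : i.Rest → ℂ) : Cone r :=
  fun s => WithLp.toLp 2 fun j => if h : (⟨s, j⟩ : Coord r) = i then 1 else w ⟨⟨s, j⟩, h⟩

theorem slice_self {m : ℕ} {r : Fin (m + 1) → ℕ} (i : Coord r) (w : i.Rest → ℂ) :
    slice i w i.1 i.2 = 1 := by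
  simp [slice]

theorem slice_ne_zero {m : ℕ} {r : Fin (m + 1) → ℕ} (i : Coord r) (w : i.Rest → ℂ) :
    slice i w ≠ 0 := by
  intro h
  have h1 := slice_self i w
  rw [h] at h1
  simp at h1

/-- The `i`-th affine chart `ℂ^{|r|-1} → {z_i ≠ 0} ⊆ P`. It is a surjective map with finite
fibres: the quotient map by the group of `a_i`-th roots of unity. -/
def chart {m : ℕ} (a : Fin (m + 1) → ℕ) {r : Fin (m + 1) → ℕ} (i : Coord r) (w : i.Rest → ℂ) :
    P a r :=
  proj a r ⟨slice i w, slice_ne_zero i w⟩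

/-- The number of points of the chart that lie over the same point of `P` as `w`. -/
def multiplicity {m : ℕ} (a : Fin (m + 1) → ℕ) {r : Fin (m + 1) → ℕ} (i : Coord r)
    (w : i.Rest → ℂ) : ℕ :=
  {w' : i.Rest → ℂ | chart a i w' = chart a i w}.ncard

open Classical in
/-- The number of nonvanishing homogeneous coordinates of the point `chart a i w`, which is the
number of affine charts whose image contains that point. -/
def chartCount {m : ℕ} {r : Fin (m + 1) → ℕ} (i : Coord r) (w : i.Rest → ℂ) : ℕ :=
  (Finset.univ.filter fun j : Coord r => slice i w j.1 j.2 ≠ 0).card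

/-- A 2-form `ω` on `P` is given by its pull-back `α = π^* ω` to `ℂ^{|r|} ∖ {0}`. This is the
expression of `ω` in the `i`-th chart, that is, `(π ∘ slice)^* ω = slice^* α`. -/
def chartForm {m : ℕ} {r : Fin (m + 1) → ℕ}
    (α : Cone r → Cone r [⋀^Fin 2]→L[ℝ] ℝ) (i : Coord r) (w : i.Rest → ℂ) :
    (i.Rest → ℂ) [⋀^Fin 2]→L[ℝ] ℝ :=
  (α (slice i w)).compContinuousLinearMap (fderiv ℝ (slice i) w)

/-- The contribution of the `i`-th chart to `∫_P f ω^{|r|-1}`: the coefficient of the top degree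
form `f ω^{|r|-1}` with respect to `dx_1 ∧ dy_1 ∧ ⋯ ∧ dx_{|r|-1} ∧ dy_{|r|-1}`, divided by the
multiplicity of the chart and by the number of charts that see the point. -/
def chartIntegrand {m : ℕ} {a r : Fin (m + 1) → ℕ} (f : P a r → ℂ)
    (α : Cone r → Cone r [⋀^Fin 2]→L[ℝ] ℝ) (i : Coord r) (w : i.Rest → ℂ) : ℂ :=
  ((wedgePow (chartForm α i w) (stdFrame i.Rest) /
    ((multiplicity a i w : ℝ) * (chartCount i w : ℝ)) : ℝ) : ℂ) * f (chart a i w)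

/-- Integrability over `P` of `f ω^{|r|-1}`, where `π^* ω = α`. -/
def IntegrableTop {m : ℕ} {a r : Fin (m + 1) → ℕ} (f : P a r → ℂ)
    (α : Cone r → Cone r [⋀^Fin 2]→L[ℝ] ℝ) : Prop :=
  ∀ i : Coord r, Integrable (chartIntegrand f α i) volume

/-- The integral `∫_P f ω^{|r|-1}`, where `π^* ω = α`. It is computed in the affine charts: the
charts cover `P`, the `i`-th one is finite-to-one onto its image `{z_i ≠ 0}`, and the functions
`1_{z_i ≠ 0} / #{j : z_j ≠ 0}` form a Borel partition of unity subordinate to the covering. -/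
def integralTop {m : ℕ} {a r : Fin (m + 1) → ℕ} (f : P a r → ℂ)
    (α : Cone r → Cone r [⋀^Fin 2]→L[ℝ] ℝ) : ℂ :=
  ∑ i : Coord r, ∫ w : i.Rest → ℂ, chartIntegrand f α i w

/-! ### The degenerate Kähler form -/

/-- `φ_{a,r,p}(z) = (1/p) log ∑_s |z_s|^{2p/a_s}`. -/
def potential {m : ℕ} (a r : Fin (m + 1) → ℕ) (p : ℝ) (z : Cone r) : ℝ :=
  (1 / p) * Real.log (∑ s, ‖z s‖ ^ (2 * p / (a s : ℝ)))

/-- The degenerate Kähler form `ω_{a,r,p}` of `P`, given by `π^* ω_{a,r,p} = dd^c φ_{a,r,p}`. -/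
def kahlerForm {m : ℕ} (a r : Fin (m + 1) → ℕ) (p : ℝ) :
    Cone r → Cone r [⋀^Fin 2]→L[ℝ] ℝ :=
  ddc (potential a r p)

/-! ### The simplex and the spheres -/

/-- `(x_1, …, x_{k-1}) ↦ (x_1, …, x_{k-1}, 1 - x_1 - ⋯ - x_{k-1})`. -/
def simplexPoint {m : ℕ} (y : Fin m → ℝ) : Fin (m + 1) → ℝ :=
  Fin.snoc (α := fun _ => ℝ) y (1 - ∑ i, y i)

/-- The measure `dx = dx_1 ⋯ dx_{k-1}` on the simplex `Δ_{k-1} = {x_s ≥ 0, ∑ x_s = 1}`. -/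
def simplexMeasure (m : ℕ) : Measure (Fin (m + 1) → ℝ) :=
  ((volume : Measure (Fin m → ℝ)).restrict
    {y | simplexPoint y ∈ stdSimplex ℝ (Fin (m + 1))}).map simplexPoint

/-- The unit sphere `S^{2n-1}` of `ℂ^n`. -/
abbrev Sph (n : ℕ) : Type := Metric.sphere (0 : EuclideanSpace ℂ (Fin n)) 1

/-- The rotation invariant probability measure on `S^{2n-1}`: the normalized area measure. -/
def sphereMeasure (n : ℕ) : Measure (Sph n) :=
  ((volume : Measure (EuclideanSpace ℂ (Fin n))).toSphere Set.univ)⁻¹ •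
    (volume : Measure (EuclideanSpace ℂ (Fin n))).toSphere

/-- The product `dμ(u) = dμ_1(u_1) ⋯ dμ_k(u_k)` on `∏_s S^{2r_s-1}`. -/
def spheresMeasure {m : ℕ} (r : Fin (m + 1) → ℕ) : Measure ((s : Fin (m + 1)) → Sph (r s)) :=
  Measure.pi fun s => sphereMeasure (r s)

/-- The point `(x_1^{a_1/2p} u_1, …, x_k^{a_k/2p} u_k)`. -/
def scaledPoint {m : ℕ} (a r : Fin (m + 1) → ℕ) (p : ℝ)
    (x : Fin (m + 1) → ℝ) (u : (s : Fin (m + 1)) → Sph (r s)) : Cone r :=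
  fun s => (x s ^ ((a s : ℝ) / (2 * p)) : ℝ) • (u s : EuclideanSpace ℂ (Fin (r s)))

/-- `f(x_1^{a_1/2p} u_1, …, x_k^{a_k/2p} u_k) ∏_s x_s^{r_s-1}/(r_s-1)!`. -/
def simplexIntegrand {m : ℕ} {a r : Fin (m + 1) → ℕ} (f : P a r → ℂ) (p : ℝ)
    (xu : (Fin (m + 1) → ℝ) × ((s : Fin (m + 1)) → Sph (r s))) : ℂ :=
  coneFun f (scaledPoint a r p xu.1 xu.2) *
    ((∏ s, xu.1 s ^ (r s - 1) / ((r s - 1).factorial : ℝ) : ℝ) : ℂ)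

end WPS

end

noncomputable section

/-! Write N = |r| and S(z) = ∑ |z_s|^{2p/a_s}. On the slice z_i = 1 the top power of the form is
(N-1)! π^{-(N-1)} times a principal minor of the complex Hessian of the potential
(`wedgePow_of_isHermitian`, `ddc_potential`). That Hessian is M - p l lᴴ, where M is block diagonal,
each block being a scalar times a rank one perturbation of the identity, and l is the conjugate
gradient. The Euler vector v = (a_s z_s), tangent to the orbits, satisfies M v = p l and lᴴ v = 1,
hence lies in the kernel. `det_minor_rank_one` then gives |v_i|² det M / p for the minor, which is a
constant times Q(z) = ∏ (|z_s|^{2p/a_s} / (S |z_s|²))^{r_s} (`homDensity`).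

The slice is not mapped to the simplex directly. Instead, for an invariant F ≥ 0, the integral of F
Q S^N e^{-S} over ℂ^N is computed twice. The measure Q dz is ℂ^*-invariant and S is homogeneous, so
integrating along the orbits of the points of the slice produces a Gamma integral that does not
depend on the orbit, times the integral of F Q over the slice (`lintegral_cone_eq_slice`). In polar
coordinates with h_s = |z_s|^{2p/a_s}, the measure Q S^N dz becomes a constant times ∏ h_s^{r_s-1}
dh dμ(u) (`lintegral_cone_gamma`). Writing h = S x with x in the simplex, another Gamma integral
removes S (`lintegral_gamma_simplex`). Comparing the two values gives `lintegral_slice_eq_simplex`.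
Since it holds for all K ∘ F with K ≥ 0 measurable, it is an equality of push-forward measures,
which handles complex functions and integrability together.

Since the weights have gcd 1, the i-th chart is generically a_i-to-one. A point with all coordinates
nonzero is seen by all N charts, and each chart turns out to contribute exactly 1/N of the answer
(`chartConst_mul`). The limit is dominated convergence, as x^{a_s/2p} → 1 for x > 0; the remaining
factor is the Dirichlet integral. -/

namespace WPS

/-! ### Top exterior powers under complex linear changes of frame -/

section LinearAlgebra

variable {J : Type*} [Fintype J] [DecidableEq J]

theorem update_pair_zero {V : Type*} (x w t : V) : Function.update ![x, w] 0 t = ![t, w] := by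
  funext i; fin_cases i <;> simp

theorem update_pair_one {V : Type*} (x w t : V) : Function.update ![w, x] 1 t = ![w, t] := by
  funext i; fin_cases i <;> simp

/-- The value of the 2-form on the blocks, as a multilinear map. -/
def blockMultilinear {V : Type*} [NormedAddCommGroup V] [NormedSpace ℝ V]
    (η : V [⋀^Fin 2]→L[ℝ] ℝ) : MultilinearMap ℝ (fun _ : J × Fin 2 => V) ℝ where
  toFun v := ∏ j : J, η ![v (j, 0), v (j, 1)]
  map_update_add' := by
    intro inst v ⟨i, b⟩ x y
    obtain rfl : inst = instDecidableEqProd := Subsingleton.elim _ _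
    rw [← Finset.mul_prod_erase _ _ (Finset.mem_univ i), ← Finset.mul_prod_erase _ _ (Finset.mem_univ i),
      ← Finset.mul_prod_erase _ _ (Finset.mem_univ i)]
    have key : ∀ t : V, ∏ j ∈ Finset.univ.erase i,
        η ![Function.update v (i, b) t (j, 0), Function.update v (i, b) t (j, 1)] =
        ∏ j ∈ Finset.univ.erase i, η ![v (j, 0), v (j, 1)] := by
      intro t
      refine Finset.prod_congr rfl fun j hj => ?_
      have : j ≠ i := Finset.ne_of_mem_erase hj
      simp [this]
    rw [key, key, key, ← add_mul]
    congr 1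
    fin_cases b
    · have h := η.map_update_add ![x, v (i, 1)] 0 x y
      rw [update_pair_zero, update_pair_zero, update_pair_zero] at h
      simpa using h
    · have h := η.map_update_add ![v (i, 0), x] 1 x y
      rw [update_pair_one, update_pair_one, update_pair_one] at h
      simpa using h
  map_update_smul' := by
    intro inst v ⟨i, b⟩ c x
    obtain rfl : inst = instDecidableEqProd := Subsingleton.elim _ _
    rw [← Finset.mul_prod_erase _ _ (Finset.mem_univ i), ← Finset.mul_prod_erase _ _ (Finset.mem_univ i)]
    have key : ∀ t : V, ∏ j ∈ Finset.univ.erase i,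
        η ![Function.update v (i, b) t (j, 0), Function.update v (i, b) t (j, 1)] =
        ∏ j ∈ Finset.univ.erase i, η ![v (j, 0), v (j, 1)] := by
      intro t
      refine Finset.prod_congr rfl fun j hj => ?_
      have : j ≠ i := Finset.ne_of_mem_erase hj
      simp [this]
    rw [key, key, smul_eq_mul, ← mul_assoc]
    congr 1
    fin_cases b
    · have h := η.map_update_smul ![x, v (i, 1)] 0 c x
      rw [update_pair_zero, update_pair_zero] at h
      simpa using h
    · have h := η.map_update_smul ![v (i, 0), x] 1 c x
      rw [update_pair_one, update_pair_one] at h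
      simpa using h

theorem wedgePow_eq_alternatization {V : Type*} [NormedAddCommGroup V] [NormedSpace ℝ V]
    (η : V [⋀^Fin 2]→L[ℝ] ℝ) (v : J × Fin 2 → V) :
    wedgePow η v =
      (1 / 2 ^ Fintype.card J) * (MultilinearMap.alternatization (blockMultilinear η)) v := by
  rw [wedgePow, MultilinearMap.alternatization_apply]
  congr 1
  refine Finset.sum_congr rfl fun σ _ => ?_
  simp [blockMultilinear, MultilinearMap.domDomCongr_apply, Units.smul_def]

/-- The standard frame as a real basis of `ℂ^J`. -/
def stdBasis (J : Type*) [Fintype J] [DecidableEq J] : Module.Basis (J × Fin 2) ℝ (J → ℂ) :=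
  (Complex.basisOneI.smulTower (Pi.basisFun ℂ J)).reindex (Equiv.prodComm _ _)

theorem coe_stdBasis : ⇑(stdBasis J) = stdFrame J := by
  funext ⟨j, b⟩
  ext k
  fin_cases b <;> simp [stdBasis, stdFrame, Module.Basis.smulTower_apply, Pi.single_apply]

/-- As an alternatization, the top power is a multiple of the determinant in the real basis, so A
multiplies it by its real determinant, and the real determinant of a complex linear map is |det A|².
-/
theorem wedgePow_comp (η : (J → ℂ) [⋀^Fin 2]→L[ℝ] ℝ) (A : (J → ℂ) →ₗ[ℂ] (J → ℂ)) :
    wedgePow η (fun b => A (stdFrame J b)) =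
      Complex.normSq (LinearMap.det A) * wedgePow η (stdFrame J) := by
  rw [wedgePow_eq_alternatization, wedgePow_eq_alternatization]
  set F := MultilinearMap.alternatization (blockMultilinear (J := J) η)
  have h := AlternatingMap.eq_smul_basis_det (stdBasis J) F
  have h2 : F (fun b => A (stdFrame J b)) = F (stdFrame J) *
      (stdBasis J).det (fun b => A (stdFrame J b)) := by
    conv_lhs => rw [h]
    simp [coe_stdBasis]
  have h3 : (stdBasis J).det (fun b => A (stdFrame J b)) =
      LinearMap.det (A.restrictScalars ℝ) * (stdBasis J).det (stdBasis J) := by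
    rw [← Module.Basis.det_comp, coe_stdBasis]; rfl
  rw [h2, h3, LinearMap.det_restrictScalars, Algebra.norm_complex_apply, Module.Basis.det_self]
  ring

end LinearAlgebra

set_option linter.unusedSectionVars false

/-! ### Top powers of Hermitian 2-forms, and minors of rank one perturbations -/

section Pfaffian

variable {J : Type*} [Fintype J] [DecidableEq J]

/-- The permutation of `J × Fin 2` that permutes the blocks by `τ` and the entries of the `j`-th
block by `ε j`. -/
def blockPerm (x : Equiv.Perm J × (J → Equiv.Perm (Fin 2))) : Equiv.Perm (J × Fin 2) :=
  Equiv.prodCongrLeft (fun _ => x.1) * Equiv.prodCongrRight x.2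

theorem blockPerm_apply (x : Equiv.Perm J × (J → Equiv.Perm (Fin 2))) (j : J) (b : Fin 2) :
    blockPerm x (j, b) = (x.1 j, x.2 j b) := by
  simp [blockPerm]

theorem blockPerm_injective : Function.Injective (blockPerm (J := J)) := by
  intro x y h
  have h' : ∀ j b, blockPerm x (j, b) = blockPerm y (j, b) := fun j b => by rw [h]
  simp only [blockPerm_apply, Prod.mk.injEq] at h'
  refine Prod.ext (Equiv.ext fun j => (h' j 0).1) (funext fun j => Equiv.ext fun b => (h' j b).2)

/-- The permutation of the blocks acts once on each of the two positions, so its sign enters squared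
and disappears. -/
theorem sign_blockPerm (x : Equiv.Perm J × (J → Equiv.Perm (Fin 2))) :
    Equiv.Perm.sign (blockPerm x) = ∏ j, Equiv.Perm.sign (x.2 j) := by
  rw [blockPerm, map_mul, Equiv.Perm.sign_prodCongrRight, Equiv.Perm.sign_prodCongrLeft]
  simp

theorem mem_range_blockPerm (σ : Equiv.Perm (J × Fin 2))
    (h : ∀ j, (σ (j, 0)).1 = (σ (j, 1)).1) : σ ∈ Set.range (blockPerm (J := J)) := by
  have h1 : ∀ j b, (σ (j, b)).1 = (σ (j, 0)).1 := by
    intro j b; fin_cases b <;> simp [h]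
  have hτ : Function.Bijective fun j => (σ (j, 0)).1 := by
    rw [← Finite.surjective_iff_bijective]
    intro k
    obtain ⟨⟨j, b⟩, hjb⟩ := σ.surjective (k, 0)
    exact ⟨j, by simp only; rw [← h1 j b, hjb]⟩
  have hε : ∀ j, Function.Bijective fun b => (σ (j, b)).2 := by
    intro j
    rw [← Finite.injective_iff_bijective]
    intro b c hbc
    have : σ (j, b) = σ (j, c) := Prod.ext (by rw [h1 j b, h1 j c]) hbc
    simpa using σ.injective this
  refine ⟨(Equiv.ofBijective _ hτ, fun j => Equiv.ofBijective _ (hε j)), ?_⟩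
  ext ⟨j, b⟩ <;> simp [blockPerm_apply, h1 j b]

/-- Basis vectors from different blocks pair to zero, so only permutations preserving the block
structure survive. There are n! 2^n of them, all with the same contribution: the signs of the swaps
inside the blocks occur once in the sign of the permutation and once in the values of the form. The
2^n cancels the normalization. -/
theorem wedgePow_of_diagonal (η : (J → ℂ) [⋀^Fin 2]→L[ℝ] ℝ) (c : ℝ) (d : J → ℝ)
    (h : ∀ v w, η ![v, w] = c * ∑ j, d j * (star (v j) * w j).im) :
    wedgePow η (stdFrame J) = (Fintype.card J).factorial * c ^ Fintype.card J * ∏ j, d j := by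
  have h0 : ∀ a b : J × Fin 2, a.1 ≠ b.1 → η ![stdFrame J a, stdFrame J b] = 0 := by
    intro a b hab
    rw [h, Finset.sum_eq_zero, mul_zero]
    intro j _
    by_cases hj : j = a.1
    · have : stdFrame J b j = 0 := by simp [stdFrame, hj, hab]
      simp [this]
    · have : stdFrame J a j = 0 := by simp [stdFrame, hj]
      simp [this]
  have h1 : ∀ (j : J) (ε : Equiv.Perm (Fin 2)),
      η ![stdFrame J (j, ε 0), stdFrame J (j, ε 1)] = c * d j * ((Equiv.Perm.sign ε : ℤ) : ℝ) := by
    intro j ε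
    rw [h, Finset.sum_eq_single j]
    · obtain rfl | rfl : ε = 1 ∨ ε = Equiv.swap 0 1 := by revert ε; decide
      · simp [stdFrame]
      · simp [stdFrame]
    · intro k _ hk
      simp [stdFrame, hk]
    · simp
  rw [wedgePow]
  have hsum : ∑ σ : Equiv.Perm (J × Fin 2), ((Equiv.Perm.sign σ : ℤ) : ℝ) *
      ∏ j : J, η ![stdFrame J (σ (j, 0)), stdFrame J (σ (j, 1))] =
      ∑ _x : Equiv.Perm J × (J → Equiv.Perm (Fin 2)), c ^ Fintype.card J * ∏ j, d j := by
    symm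
    refine Fintype.sum_of_injective blockPerm blockPerm_injective _ _ ?_ ?_
    · intro σ hσ
      have : ¬ ∀ j, (σ (j, 0)).1 = (σ (j, 1)).1 := fun hh => hσ (mem_range_blockPerm σ hh)
      push Not at this
      obtain ⟨j, hj⟩ := this
      rw [Finset.prod_eq_zero (Finset.mem_univ j) (h0 _ _ hj), mul_zero]
    · intro x
      simp only [blockPerm_apply, h1, sign_blockPerm]
      rw [Finset.prod_mul_distrib, Finset.prod_mul_distrib, Finset.prod_const, Finset.card_univ,
        Equiv.prod_comp x.1 d]
      push_cast
      have : (∏ j, ((Equiv.Perm.sign (x.2 j) : ℤ) : ℝ)) * ∏ j, ((Equiv.Perm.sign (x.2 j) : ℤ) : ℝ)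
          = 1 := by
        rw [← Finset.prod_mul_distrib]
        refine Finset.prod_eq_one fun j _ => ?_
        rw [← Int.cast_mul]
        simp
      linear_combination -(c ^ Fintype.card J * ∏ j, d j) * this
  rw [hsum, Finset.sum_const, Finset.card_univ, Fintype.card_prod, Fintype.card_perm,
    Fintype.card_fun, Fintype.card_perm, Fintype.card_fin]
  simp only [nsmul_eq_mul]
  push_cast
  simp only [Nat.factorial]
  field_simp
  norm_num

/-- Diagonalize by a unitary matrix U: the change of frame costs only |det U|² = 1, and the product
of the eigenvalues is the determinant. -/
theorem wedgePow_of_isHermitian (η : (J → ℂ) [⋀^Fin 2]→L[ℝ] ℝ) (c : ℝ) (H : Matrix J J ℂ)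
    (hH : H.IsHermitian)
    (h : ∀ v w, η ![v, w] = c * (star v ⬝ᵥ H.mulVec w).im) :
    wedgePow η (stdFrame J) =
      (Fintype.card J).factorial * c ^ Fintype.card J * H.det.re := by
  set U : Matrix J J ℂ := (hH.eigenvectorUnitary : Matrix J J ℂ) with hU
  have hspec : star U * H * U = Matrix.diagonal (RCLike.ofReal ∘ hH.eigenvalues) := by
    have := hH.spectral_theorem
    rw [Unitary.conjStarAlgAut_apply] at this
    conv_lhs => rw [this]
    have h1 : star U * U = 1 := Unitary.coe_star_mul_self _
    rw [← hU, show star (hH.eigenvectorUnitary : Matrix J J ℂ) = star U from rfl]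
    calc _ = (star U * U) * Matrix.diagonal (RCLike.ofReal ∘ hH.eigenvalues) * (star U * U) := by
          simp only [mul_assoc]
      _ = _ := by rw [h1]; simp
  let A : (J → ℂ) →L[ℝ] (J → ℂ) :=
    LinearMap.toContinuousLinearMap ((Matrix.toLin' U).restrictScalars ℝ)
  have hA : ∀ v, A v = U.mulVec v := fun v => rfl
  have hd := wedgePow_of_diagonal (η.compContinuousLinearMap A) c hH.eigenvalues (by
    intro v w
    have : (η.compContinuousLinearMap A) ![v, w] = η ![U.mulVec v, U.mulVec w] := by
      rw [ContinuousAlternatingMap.compContinuousLinearMap_apply]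
      congr 1
      funext i; fin_cases i <;> simp [hA]
    rw [this, h]
    congr 1
    have : star (U.mulVec v) ⬝ᵥ H.mulVec (U.mulVec w) =
        star v ⬝ᵥ (star U * H * U).mulVec w := by
      rw [Matrix.star_mulVec, ← Matrix.dotProduct_mulVec, Matrix.mulVec_mulVec, Matrix.mulVec_mulVec,
        Matrix.star_eq_conjTranspose, mul_assoc]
    rw [this, hspec, dotProduct, Complex.im_sum]
    refine Finset.sum_congr rfl fun j _ => ?_
    simp only [Matrix.mulVec_diagonal, Pi.star_apply, Function.comp_apply]
    have : star (v j) * ((RCLike.ofReal (hH.eigenvalues j) : ℂ) * w j) =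
      ((hH.eigenvalues j : ℝ) : ℂ) * (star (v j) * w j) := by
        simp only [RCLike.ofReal_eq_complex_ofReal]; ring
    rw [this, Complex.im_ofReal_mul])
  have hc : wedgePow (η.compContinuousLinearMap A) (stdFrame J) =
      wedgePow η (fun b => Matrix.toLin' U (stdFrame J b)) := by
    unfold wedgePow
    congr 1
    refine Finset.sum_congr rfl fun σ _ => ?_
    congr 1
    refine Finset.prod_congr rfl fun j _ => ?_
    rw [ContinuousAlternatingMap.compContinuousLinearMap_apply]
    congr 1
    funext i; fin_cases i <;> rfl
  have hdetU : Complex.normSq (LinearMap.det (Matrix.toLin' U)) = 1 := by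
    rw [LinearMap.det_toLin']
    have h1 : star U * U = 1 := Unitary.coe_star_mul_self _
    have h2 := congrArg Matrix.det h1
    rw [Matrix.det_mul, Matrix.star_eq_conjTranspose, Matrix.det_conjTranspose, Matrix.det_one] at h2
    have h3 : ((Complex.normSq U.det : ℝ) : ℂ) = 1 := by
      rw [Complex.normSq_eq_conj_mul_self]; exact h2
    exact_mod_cast h3
  rw [hc, wedgePow_comp, hdetU, one_mul] at hd
  rw [hd, hH.det_eq_prod_eigenvalues]
  congr 1
  rw [← Complex.ofReal_re (∏ j, hH.eigenvalues j)]
  push_cast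
  rfl

/-- The determinant of the minor of `M - p l lᴴ` when this matrix has the kernel vector `v`. -/
theorem det_minor_rank_one (M : Matrix J J ℂ) (l v : J → ℂ) (p : ℂ) (i : J)
    (hMv : M.mulVec v = p • l) (hvM : Matrix.vecMul (star v) M = p • star l)
    (hl : star l ⬝ᵥ v = 1) :
    p * ((M - p • Matrix.vecMulVec l (star l)).toSquareBlockProp (fun j => j ≠ i)).det =
      star (v i) * v i * M.det := by
  -- C places v in column i, so column i of M C is p l. R then adds -conj(l_b) times that column to
  -- every other column b, which creates M - p l lᴴ there. B finally replaces row i by its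
  -- combination with coefficients vᴴ, which is (p at i, 0 elsewhere) because vᴴ annihilates M - p l
  -- lᴴ. The product is block triangular with blocks p and the wanted minor, while the determinants
  -- of B, R and C are conj(v_i), 1 and v_i.
  set R : Matrix J J ℂ := Matrix.updateRow 1 i (fun j => if j = i then 1 else - star (l j)) with hR
  set C : Matrix J J ℂ := Matrix.updateCol 1 i v with hC
  set B : Matrix J J ℂ := Matrix.updateRow 1 i (star v) with hB
  have hlv : star v ⬝ᵥ l = 1 := by
    rw [Matrix.star_dotProduct, hl, star_one]
  have detRow : ∀ r : J → ℂ, (Matrix.updateRow (1 : Matrix J J ℂ) i r).det = r i := by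
    intro r
    rw [← Matrix.cramer_transpose_apply]; simp
  have detC : C.det = v i := by
    rw [hC, ← Matrix.cramer_apply]; simp
  have e1 : ∀ a b, (M * C) a b = if b = i then p * l a else M a b := by
    intro a b
    rw [Matrix.mul_apply]
    split_ifs with hb
    · subst hb
      have := congrFun hMv a
      simpa [Matrix.mulVec, dotProduct, hC] using this
    · simp [hC, hb, Matrix.one_apply]
  have e2 : ∀ a b, (M * C * R) a b =
      if b = i then p * l a else (M - p • Matrix.vecMulVec l (star l)) a b := by
    intro a b
    rw [Matrix.mul_apply]
    by_cases hb : b = i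
    · rw [Finset.sum_eq_single i]
      · simp [hR, hb, e1]
      · intro k _ hk
        simp [hR, hb, hk, Matrix.updateRow_apply]
      · simp
    · rw [Finset.sum_eq_add_of_mem i b (Finset.mem_univ _) (Finset.mem_univ _) (Ne.symm hb)]
      · simp [hR, hb, e1, Matrix.updateRow_apply, Matrix.vecMulVec_apply]
        ring
      · intro k _ hk
        simp [hR, hk.1, Matrix.updateRow_apply, hk.2]
  have e3 : ∀ a b, (B * (M * C * R)) a b = if a = i then (if b = i then p else 0) else
      (M * C * R) a b := by
    intro a b
    rw [Matrix.mul_apply]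
    split_ifs with ha hb
    · subst ha hb
      simp only [e2, if_true, hB, Matrix.updateRow_self]
      calc ∑ k, star v k * (p * l k) = p * (star v ⬝ᵥ l) := by
            rw [dotProduct, Finset.mul_sum]
            exact Finset.sum_congr rfl fun k _ => by ring
        _ = p := by rw [hlv, mul_one]
    · subst ha
      simp only [e2, if_neg hb, hB, Matrix.updateRow_self]
      have h1 := congrFun hvM b
      simp only [Matrix.vecMul, Pi.smul_apply, smul_eq_mul] at h1
      have h2 : ∑ x, star v x * (M - p • Matrix.vecMulVec l (star l)) x b =
          star v ⬝ᵥ (fun x => M x b) - p * (star v ⬝ᵥ l) * star l b := by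
        simp only [dotProduct, Matrix.sub_apply, Matrix.smul_apply, Matrix.vecMulVec_apply,
          smul_eq_mul, mul_sub, Finset.sum_sub_distrib, Finset.mul_sum, Finset.sum_mul]
        congr 1
        exact Finset.sum_congr rfl fun k _ => by ring
      rw [h2, hlv, h1]; ring
    · simp [hB, ha, Matrix.updateRow_apply, Matrix.one_apply]
  have hdet : (B * (M * C * R)).det = star (v i) * v i * M.det := by
    rw [Matrix.det_mul, Matrix.det_mul, Matrix.det_mul, hB, hR, detRow, detRow, detC]
    simp; ring
  rw [← hdet, Matrix.twoBlockTriangular_det _ (fun j => j ≠ i)]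
  · rw [mul_comm]
    congr 1
    · congr 1
      ext ⟨a, ha⟩ ⟨b, hb⟩
      simp only [Matrix.toSquareBlockProp_def, Matrix.of_apply]
      rw [e3, if_neg ha, e2, if_neg hb]
    · have : Unique {a // ¬ a ≠ i} := ⟨⟨⟨i, by simp⟩⟩, fun x => Subtype.ext (by simpa using x.2)⟩
      rw [Matrix.det_unique]
      have hd : ((default : {a // ¬ a ≠ i}) : J) = i := by simpa using (default : {a // ¬ a ≠ i}).2
      simp [Matrix.toSquareBlockProp_def, hd, e3]
  · intro a ha b hb
    have : a = i := by simpa using ha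
    rw [e3, if_pos this, if_neg hb]

end Pfaffian

/-! ### Block diagonal matrices with blocks d_s (1 + β_s z_s z_sᴴ) -/

section BlockMatrix

variable {m : ℕ} {r : Fin (m + 1) → ℕ}

/-- The block diagonal matrix with the blocks `d_s (1 + β_s z_s z_sᴴ)`. -/
def blockMatrix (d β : Fin (m + 1) → ℝ) (z : Coord r → ℂ) : Matrix (Coord r) (Coord r) ℂ :=
  Matrix.of fun c c' => if c.1 = c'.1 then
    (d c.1 : ℂ) * ((1 : Matrix (Coord r) (Coord r) ℂ) c c' + β c.1 * (z c * star (z c'))) else 0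

theorem blockMatrix_isHermitian (d β : Fin (m + 1) → ℝ) (z : Coord r → ℂ) :
    (blockMatrix d β z).IsHermitian := by
  ext c c'
  simp only [Matrix.conjTranspose_apply, blockMatrix, Matrix.of_apply, eq_comm (a := c'.1)]
  split_ifs with h
  · rw [← h]
    have : star ((1 : Matrix (Coord r) (Coord r) ℂ) c' c) = (1 : Matrix (Coord r) (Coord r) ℂ) c c' := by
      simp only [Matrix.one_apply, eq_comm (a := c')]
      split_ifs <;> simp
    simp only [star_mul', star_add, this, star_star]
    simp only [RCLike.star_def, Complex.conj_ofReal]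
    ring
  · simp

/-- Block by block, this is the matrix determinant lemma det(1 + x yᴴ) = 1 + yᴴ x. -/
theorem blockMatrix_det (d β : Fin (m + 1) → ℝ) (z : Coord r → ℂ) :
    (blockMatrix d β z).det =
      ∏ s, ((d s : ℂ) ^ r s * (1 + β s * ∑ j, star (z ⟨s, j⟩) * z ⟨s, j⟩)) := by
  have hbt : (blockMatrix d β z).BlockTriangular Sigma.fst := by
    intro c c' h
    simp [blockMatrix, ne_of_gt h]
  rw [hbt.det_fintype]
  refine Finset.prod_congr rfl fun s _ => ?_
  rw [← Matrix.det_submatrix_equiv_self (Equiv.sigmaSubtype s).symm]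
  have : ((blockMatrix d β z).toSquareBlock Sigma.fst s).submatrix
      (Equiv.sigmaSubtype s).symm (Equiv.sigmaSubtype s).symm =
      (d s : ℂ) • (1 + Matrix.vecMulVec (fun j => β s * z ⟨s, j⟩) (fun j => star (z ⟨s, j⟩))) := by
    ext j k
    simp [blockMatrix, Matrix.toSquareBlock_def, Matrix.vecMulVec_apply, Matrix.one_apply,
      Equiv.sigmaSubtype, mul_assoc]
  rw [this, Matrix.det_smul, Fintype.card_fin, Matrix.vecMulVec_eq Unit,
    Matrix.det_one_add_replicateCol_mul_replicateRow]
  congr 2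
  simp only [dotProduct, Finset.mul_sum]
  exact Finset.sum_congr rfl fun j _ => by ring

theorem blockMatrix_mulVec (d β : Fin (m + 1) → ℝ) (z w : Coord r → ℂ) (c : Coord r) :
    (blockMatrix d β z).mulVec w c =
      d c.1 * (w c + β c.1 * z c * ∑ j, star (z ⟨c.1, j⟩) * w ⟨c.1, j⟩) := by
  rw [Matrix.mulVec, dotProduct, Fintype.sum_sigma, Finset.sum_eq_single c.1]
  · simp only [blockMatrix, Matrix.of_apply, if_true, mul_add, add_mul, Finset.sum_add_distrib]
    congr 1
    · rw [Finset.sum_eq_single c.2]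
      · simp
      · rintro k - hk
        have : c ≠ ⟨c.1, k⟩ := fun h => hk (by cases c; simpa using (Sigma.mk.inj_iff.1 h).2.symm)
        simp [Matrix.one_apply_ne this]
      · simp
    · simp only [Finset.mul_sum]
      exact Finset.sum_congr rfl fun j _ => by ring
  · intro s _ hs
    refine Finset.sum_eq_zero fun j _ => ?_
    simp [blockMatrix, Ne.symm hs]
  · simp

end BlockMatrix

/-! ### The 2-form dd^c in terms of second derivatives -/

section Ddc

variable {E : Type*} [NormedAddCommGroup E] [NormedSpace ℂ E]

theorem dc_apply (u : E → ℝ) (z : E) (v : Fin 1 → E) :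
    dc u z v = -(1 / (4 * Real.pi)) * fderiv ℝ u z (Complex.I • v 0) := by
  simp [dc]

/-- The exterior derivative evaluated on constant vector fields, where no bracket term occurs. -/
theorem ddc_apply (u : E → ℝ) (z : E) (hd : DifferentiableAt ℝ (fderiv ℝ u) z) (v w : E) :
    ddc u z ![v, w] = -(1 / (4 * Real.pi)) *
      (fderiv ℝ (fun x => fderiv ℝ u x (Complex.I • w)) z v -
        fderiv ℝ (fun x => fderiv ℝ u x (Complex.I • v)) z w) := by
  have hdc : DifferentiableAt ℝ (dc u) z := by
    refine ((ContinuousAlternatingMap.ofSubsingletonLIE (𝕜 := ℝ) (E := E) (F := ℝ)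
      (0 : Fin 1)).differentiable _).comp (f := fun z => (-(1 / (4 * Real.pi))) •
      (fderiv ℝ u z).comp ((Complex.I • ContinuousLinearMap.id ℂ E).restrictScalars ℝ)) z ?_
    exact (hd.clm_comp (differentiableAt_const
      ((Complex.I • ContinuousLinearMap.id ℂ E).restrictScalars ℝ : E →L[ℝ] E))).const_smul
      (-(1 / (4 * Real.pi)))
  have h : ∀ y : E, DifferentiableAt ℝ (fun x => fderiv ℝ u x y) z := fun y =>
    hd.clm_apply (by fun_prop)
  rw [ddc, extDeriv_apply hdc, Fin.sum_univ_succ]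
  simp only [dc_apply]
  rw [fderiv_const_mul (h _)]
  simp only [Finset.univ_unique, Finset.sum_singleton]
  rw [fderiv_const_mul (h _)]
  simp [Fin.removeNth]
  ring

end Ddc

/-! ### First and second derivatives of the potential where all z_s are nonzero -/

section Potential

variable {m : ℕ} {a r : Fin (m + 1) → ℕ} {p : ℝ}

/-- `S(z) = ∑ |z_s|^{2p/a_s}`. -/
def radialSum (a r : Fin (m + 1) → ℕ) (p : ℝ) (z : Cone r) : ℝ :=
  ∑ s, ‖z s‖ ^ (2 * p / (a s : ℝ))

/-- `|z_s|^{2p/a_s} / (a_s |z_s|² S(z))`. -/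
def radialCoeff (a r : Fin (m + 1) → ℕ) (p : ℝ) (z : Cone r) (s : Fin (m + 1)) : ℝ :=
  ‖z s‖ ^ (2 * p / (a s : ℝ)) / (a s * ‖z s‖ ^ 2 * radialSum a r p z)

/-- Powers of |z_s| are differentiated as powers of the smooth function |z_s|². -/
theorem norm_rpow_two_mul_div {V : Type*} [NormedAddCommGroup V] (x : V) (p q : ℝ) :
    ‖x‖ ^ (2 * p / q) = (‖x‖ ^ 2) ^ (p / q) := by
  rw [← Real.rpow_natCast, ← Real.rpow_mul (norm_nonneg _)]
  congr 1; push_cast; ring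

theorem radialSum_pos {z : Cone r} (hz : ∀ s, z s ≠ 0) : 0 < radialSum a r p z :=
  Finset.sum_pos (fun s _ => Real.rpow_pos_of_pos (norm_pos_iff.2 (hz s)) _) Finset.univ_nonempty

/-- The coordinate functional `v ↦ Re ⟨z_s, v_s⟩`. -/
def innerCoord (z : Cone r) (s : Fin (m + 1)) : Cone r →L[ℝ] ℝ :=
  (innerSL ℝ (z s)).comp (ContinuousLinearMap.proj s)

theorem innerCoord_apply (z v : Cone r) (s : Fin (m + 1)) :
    innerCoord z s v = inner ℝ (z s) (v s) := rfl

theorem hasFDerivAt_norm_rpow (z : Cone r) (s : Fin (m + 1)) (hz : z s ≠ 0) (q : ℝ) :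
    HasFDerivAt (fun x : Cone r => (‖x s‖ ^ 2) ^ q)
      ((q * (‖z s‖ ^ 2) ^ (q - 1)) • (2 : ℝ) • innerCoord z s) z := by
  have h := (hasFDerivAt_apply (𝕜 := ℝ) s z).norm_sq
  have h2 := h.rpow_const (p := q) (Or.inl (by have := norm_pos_iff.2 hz; positivity))
  refine h2.congr_fderiv ?_
  ext v
  simp [innerCoord]

theorem hasFDerivAt_radialSum (ha : ∀ s, 0 < a s) {z : Cone r} (hz : ∀ s, z s ≠ 0) :
    HasFDerivAt (radialSum a r p)
      ((2 * p * radialSum a r p z) • ∑ s, radialCoeff a r p z s • innerCoord z s) z := by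
  have h : HasFDerivAt (fun x : Cone r => ∑ s, (‖x s‖ ^ 2) ^ (p / (a s : ℝ))) _ z :=
    HasFDerivAt.fun_sum fun s _ => hasFDerivAt_norm_rpow z s (hz s) (p / (a s : ℝ))
  have he : radialSum a r p = fun x : Cone r => ∑ s, (‖x s‖ ^ 2) ^ (p / (a s : ℝ)) := by
    funext x
    simp only [radialSum, norm_rpow_two_mul_div]
  refine (h.congr_of_eventuallyEq (.of_forall fun x => congrFun he x)).congr_fderiv ?_
  rw [Finset.smul_sum]
  refine Finset.sum_congr rfl fun s _ => ?_
  rw [smul_smul, smul_smul]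
  congr 1
  have h1 : 0 < ‖z s‖ := norm_pos_iff.2 (hz s)
  have h2 := radialSum_pos (a := a) (p := p) hz
  have h3 : (0 : ℝ) < a s := by exact_mod_cast ha s
  rw [radialCoeff, norm_rpow_two_mul_div, Real.rpow_sub_one (by positivity)]
  field_simp

theorem hasFDerivAt_potential (ha : ∀ s, 0 < a s) (hp : 0 < p) {z : Cone r} (hz : ∀ s, z s ≠ 0) :
    HasFDerivAt (potential a r p)
      ((2 : ℝ) • ∑ s, radialCoeff a r p z s • innerCoord z s) z := by
  have h2 := radialSum_pos (a := a) (p := p) hz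
  have h := ((hasFDerivAt_radialSum (p := p) ha hz).log h2.ne').const_mul (1 / p)
  refine h.congr_fderiv ?_
  rw [smul_smul, smul_smul]
  congr 1
  field_simp

/-- A logarithmic derivative: the coefficient is |z_s|^{2(p/a_s - 1)} / (a_s S). The first term
comes from the power of |z_s|², and the second from 1/S. -/
theorem hasFDerivAt_radialCoeff (ha : ∀ s, 0 < a s) {z : Cone r}
    (hz : ∀ s, z s ≠ 0) (s : Fin (m + 1)) :
    HasFDerivAt (fun x => radialCoeff a r p x s)
      ((radialCoeff a r p z s) • ((2 * ((p / a s - 1) / ‖z s‖ ^ 2)) • innerCoord z s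
        - (2 * p) • ∑ t, radialCoeff a r p z t • innerCoord z t)) z := by
  have hpos := radialSum_pos (a := a) (p := p) hz
  have h1 : 0 < ‖z s‖ := norm_pos_iff.2 (hz s)
  have h3 : (0 : ℝ) < a s := by exact_mod_cast ha s
  have hA := (hasFDerivAt_norm_rpow z s (hz s) (p / (a s : ℝ) - 1)).const_mul (1 / (a s : ℝ))
  have hB := (hasDerivAt_inv hpos.ne').comp_hasFDerivAt z (hasFDerivAt_radialSum (p := p) ha hz)
  have hC := hA.mul hB
  have hopen : ∀ᶠ x : Cone r in 𝓝 z, x s ≠ 0 :=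
    (continuous_apply s).continuousAt.eventually_ne (hz s)
  have hE : (fun x => radialCoeff a r p x s) =ᶠ[𝓝 z]
      (fun x : Cone r => (1 / (a s : ℝ) * (‖x s‖ ^ 2) ^ (p / (a s : ℝ) - 1))
        * (Inv.inv ∘ radialSum a r p) x) := by
    filter_upwards [hopen] with x hx
    have : 0 < ‖x s‖ := norm_pos_iff.2 hx
    rw [radialCoeff, norm_rpow_two_mul_div, Real.rpow_sub_one (by positivity)]
    simp only [Function.comp_apply]
    field_simp
  refine (hC.congr_of_eventuallyEq hE).congr_fderiv ?_
  ext v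
  have hval : radialCoeff a r p z s =
      1 / (a s : ℝ) * ((‖z s‖ ^ 2) ^ (p / (a s : ℝ)) / ‖z s‖ ^ 2) * (radialSum a r p z)⁻¹ := by
    rw [radialCoeff, norm_rpow_two_mul_div]; field_simp
  simp only [add_apply, smul_apply, smul_eq_mul,
    sub_apply, Function.comp_apply]
  have hne : ‖z s‖ ^ 2 ≠ 0 := by positivity
  simp only [Real.rpow_sub_one hne]
  generalize (∑ t, radialCoeff a r p z t • innerCoord z t) v = Λ
  rw [hval]
  field_simp
  ring

theorem eventually_forall_ne {z : Cone r} (hz : ∀ s, z s ≠ 0) :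
    ∀ᶠ x : Cone r in 𝓝 z, ∀ s, x s ≠ 0 :=
  eventually_all.2 fun s => (continuous_apply s).continuousAt.eventually_ne (hz s)

theorem differentiableAt_fderiv_potential (ha : ∀ s, 0 < a s) (hp : 0 < p) {z : Cone r}
    (hz : ∀ s, z s ≠ 0) : DifferentiableAt ℝ (fderiv ℝ (potential a r p)) z := by
  have hE : fderiv ℝ (potential a r p) =ᶠ[𝓝 z]
      fun x => (2 : ℝ) • ∑ s, radialCoeff a r p x s • innerCoord x s := by
    filter_upwards [eventually_forall_ne hz] with x hx
    exact (hasFDerivAt_potential ha hp hx).fderiv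
  rw [hE.differentiableAt_iff]
  suffices h : ∀ s ∈ (Finset.univ : Finset (Fin (m + 1))), DifferentiableAt ℝ
      (fun x : Cone r => radialCoeff a r p x s • innerCoord x s) z from
    (DifferentiableAt.fun_sum h).const_smul (2 : ℝ)
  intro s _
  refine DifferentiableAt.smul (hasFDerivAt_radialCoeff ha hz s).differentiableAt ?_
  unfold innerCoord
  exact ((innerSL ℝ).differentiableAt.comp z (differentiableAt_apply (𝕜 := ℝ) s z)).clm_comp
    (differentiableAt_const (ContinuousLinearMap.proj s : Cone r →L[ℝ] _))

theorem fderiv_fderiv_potential (ha : ∀ s, 0 < a s) (hp : 0 < p) {z : Cone r}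
    (hz : ∀ s, z s ≠ 0) (v w : Cone r) :
    fderiv ℝ (fun x => fderiv ℝ (potential a r p) x w) z v =
      2 * ∑ s, radialCoeff a r p z s * (inner ℝ (v s) (w s) +
        (2 * ((p / a s - 1) / ‖z s‖ ^ 2) * inner ℝ (z s) (v s)
        - 2 * p * ∑ t, radialCoeff a r p z t * inner ℝ (z t) (v t)) * inner ℝ (z s) (w s)) := by
  have hE : (fun x => fderiv ℝ (potential a r p) x w) =ᶠ[𝓝 z]
      fun x => 2 * ∑ s, radialCoeff a r p x s * inner ℝ (x s) (w s) := by
    filter_upwards [eventually_forall_ne hz] with x hx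
    rw [(hasFDerivAt_potential ha hp hx).fderiv]
    simp [innerCoord_apply]
  rw [hE.fderiv_eq]
  have hin : ∀ s, HasFDerivAt (fun x : Cone r => inner ℝ (x s) (w s))
      (innerCoord w s) z := by
    intro s
    have : (fun x : Cone r => inner ℝ (x s) (w s)) = innerCoord w s := by
      funext x; rw [innerCoord_apply, real_inner_comm]
    rw [this]
    exact (innerCoord w s).hasFDerivAt
  have hF : HasFDerivAt (fun x : Cone r => 2 * ∑ s, radialCoeff a r p x s * inner ℝ (x s) (w s)) _ z :=
    (HasFDerivAt.fun_sum fun s _ => (hasFDerivAt_radialCoeff (p := p) ha hz s).mul (hin s)).const_mul 2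
  rw [hF.fderiv]
  simp only [smul_apply, smul_eq_mul, sum_apply,
    add_apply, sub_apply, innerCoord_apply]
  congr 1
  refine Finset.sum_congr rfl fun s _ => ?_
  rw [real_inner_comm (w s) (v s)]
  ring

end Potential

/-! ### The complex Hessian and the volume density in an affine chart -/

section Levi

variable {m : ℕ} {a r : Fin (m + 1) → ℕ} {p : ℝ}

/-- The scalar coordinates of a point. -/
def flat (z : Cone r) (c : Coord r) : ℂ := z c.1 c.2

theorem inner_real_eq {n : ℕ} (x y : EuclideanSpace ℂ (Fin n)) :
    inner ℝ x y = (∑ j, star (x j) * y j).re := by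
  rw [PiLp.inner_apply, Complex.re_sum]
  refine Finset.sum_congr rfl fun j _ => ?_
  rw [Complex.inner, mul_comm]
  rfl

theorem sum_star_mul_self {n : ℕ} (x : EuclideanSpace ℂ (Fin n)) :
    ∑ j, star (x j) * x j = ((‖x‖ ^ 2 : ℝ) : ℂ) := by
  rw [EuclideanSpace.norm_sq_eq]
  push_cast
  refine Finset.sum_congr rfl fun j _ => ?_
  rw [← Complex.conj_mul']
  rfl

/-- The exponent-dependent coefficient `(p/a_s - 1)/|z_s|²`. -/
def rankOneCoeff (a r : Fin (m + 1) → ℕ) (p : ℝ) (z : Cone r) (s : Fin (m + 1)) : ℝ :=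
  (p / a s - 1) / ‖z s‖ ^ 2

/-- The matrix of the Levi form of `S` divided by `p S`. -/
def sumMatrix (a r : Fin (m + 1) → ℕ) (p : ℝ) (z : Cone r) : Matrix (Coord r) (Coord r) ℂ :=
  blockMatrix (radialCoeff a r p z) (rankOneCoeff a r p z) (flat z)

/-- The vector of the conjugates of the `∂φ/∂z_j`. -/
def gradVec (a r : Fin (m + 1) → ℕ) (p : ℝ) (z : Cone r) (c : Coord r) : ℂ :=
  radialCoeff a r p z c.1 * flat z c

/-- The complex Hessian of the potential. -/
def leviMatrix (a r : Fin (m + 1) → ℕ) (p : ℝ) (z : Cone r) : Matrix (Coord r) (Coord r) ℂ :=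
  sumMatrix a r p z - (p : ℂ) • Matrix.vecMulVec (gradVec a r p z) (star (gradVec a r p z))

theorem sumMatrix_isHermitian (z : Cone r) : (sumMatrix a r p z).IsHermitian :=
  blockMatrix_isHermitian _ _ _

theorem leviMatrix_isHermitian (z : Cone r) : (leviMatrix a r p z).IsHermitian := by
  refine (blockMatrix_isHermitian _ _ _).sub ?_
  ext c c'
  simp [Matrix.vecMulVec_apply, mul_comm]

theorem leviMatrix_form (z v w : Cone r) :
    (star (flat v) ⬝ᵥ (leviMatrix a r p z).mulVec (flat w)) =
      ∑ s, (radialCoeff a r p z s : ℂ) * ((∑ j, star (v s j) * w s j) + rankOneCoeff a r p z s *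
        (star (∑ j, star (z s j) * v s j) * ∑ j, star (z s j) * w s j))
      - p * (star (∑ s, (radialCoeff a r p z s : ℂ) * ∑ j, star (z s j) * v s j) *
        ∑ s, (radialCoeff a r p z s : ℂ) * ∑ j, star (z s j) * w s j) := by
  rw [leviMatrix, Matrix.sub_mulVec, dotProduct_sub]
  congr 1
  · rw [dotProduct, Fintype.sum_sigma]
    refine Finset.sum_congr rfl fun s _ => ?_
    simp only [sumMatrix, blockMatrix_mulVec, flat, Pi.star_apply]
    simp only [mul_add, Finset.sum_add_distrib]
    congr 1
    · rw [Finset.mul_sum]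
      exact Finset.sum_congr rfl fun j _ => by ring
    · simp only [star_sum, star_mul', star_star]
      rw [Finset.sum_mul, Finset.mul_sum, Finset.mul_sum]
      exact Finset.sum_congr rfl fun j _ => by ring
  · rw [Matrix.smul_mulVec, dotProduct_smul, smul_eq_mul, Matrix.vecMulVec_mulVec]
    congr 1
    have h1 : ∀ u : Cone r, star (gradVec a r p z) ⬝ᵥ flat u =
        ∑ s, (radialCoeff a r p z s : ℂ) * ∑ j, star (z s j) * u s j := by
      intro u
      rw [dotProduct, Fintype.sum_sigma]
      refine Finset.sum_congr rfl fun s _ => ?_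
      rw [Finset.mul_sum]
      refine Finset.sum_congr rfl fun j _ => ?_
      simp [gradVec, flat]
      ring
    have h2 : star (flat v) ⬝ᵥ gradVec a r p z =
        star (∑ s, (radialCoeff a r p z s : ℂ) * ∑ j, star (z s j) * v s j) := by
      rw [← h1 v, Matrix.star_dotProduct]
    rw [← h1 w, ← h2]
    simp [mul_comm]

/-- Put i w, respectively i v, into the second derivative and antisymmetrize: the part symmetric in
the two arguments cancels, leaving the imaginary part of the Hermitian form. The constant is -(1/4π)
· 2 · (-2) = 1/π, with 2 from the second derivative and -2 from the antisymmetrization. -/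
theorem ddc_potential (ha : ∀ s, 0 < a s) (hp : 0 < p) {z : Cone r} (hz : ∀ s, z s ≠ 0)
    (v w : Cone r) :
    ddc (potential a r p) z ![v, w] =
      (1 / Real.pi) * (star (flat v) ⬝ᵥ (leviMatrix a r p z).mulVec (flat w)).im := by
  rw [ddc_apply _ _ (differentiableAt_fderiv_potential ha hp hz), fderiv_fderiv_potential ha hp hz,
    fderiv_fderiv_potential ha hp hz, leviMatrix_form]
  have hI : ∀ x y : Cone r, ∀ s, ∑ j, star (x s j) * (Complex.I • y) s j =
      Complex.I * ∑ j, star (x s j) * y s j := by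
    intro x y s
    rw [Finset.mul_sum]
    refine Finset.sum_congr rfl fun j _ => ?_
    simp
    ring
  have hwv : ∀ s, ∑ j, star (w s j) * v s j = star (∑ j, star (v s j) * w s j) := by
    intro s
    rw [star_sum]
    refine Finset.sum_congr rfl fun j _ => ?_
    simp
    ring
  simp only [inner_real_eq, hI, hwv]
  generalize hX : (fun s => ∑ j, star (v s j) * w s j) = X
  generalize hV : (fun s => ∑ j, star (z s j) * v s j) = V
  generalize hW : (fun s => ∑ j, star (z s j) * w s j) = W
  have hX' : ∀ s, ∑ j, star (v s j) * w s j = X s := fun s => congrFun hX s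
  have hV' : ∀ s, ∑ j, star (z s j) * v s j = V s := fun s => congrFun hV s
  have hW' : ∀ s, ∑ j, star (z s j) * w s j = W s := fun s => congrFun hW s
  simp only [hX', hV', hW', ← rankOneCoeff.eq_1]
  generalize radialCoeff a r p z = q
  generalize rankOneCoeff a r p z = β
  have e1 : ∀ Y : Fin (m + 1) → ℂ, (∑ s, (q s : ℂ) * Y s).re = ∑ s, q s * (Y s).re := by
    intro Y; simp [Complex.re_sum]
  have e2 : ∀ Y : Fin (m + 1) → ℂ, (∑ s, (q s : ℂ) * Y s).im = ∑ s, q s * (Y s).im := by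
    intro Y; simp [Complex.im_sum]
  rw [Complex.sub_im, e2, Complex.im_ofReal_mul, Complex.mul_im]
  simp only [Complex.star_def, Complex.conj_re, Complex.conj_im, e1, e2]
  simp only [Complex.add_im, Complex.mul_im, Complex.mul_re, Complex.conj_re,
    Complex.conj_im, Complex.I_re, Complex.I_im, zero_mul, one_mul, zero_sub, Complex.ofReal_re,
    Complex.ofReal_im, add_zero]
  generalize ∑ s, q s * (V s).re = Rv
  generalize ∑ s, q s * (W s).re = Rw
  have hIv : ∑ s, q s * (V s).im * (2 * p * Rw) = (∑ s, q s * (V s).im) * (2 * p * Rw) := by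
    rw [Finset.sum_mul]
  have hIw : ∑ s, q s * (W s).im * (2 * p * Rv) = (∑ s, q s * (W s).im) * (2 * p * Rv) := by
    rw [Finset.sum_mul]
  -- The terms in p are products of two sums over s, so they are kept as products; all the others
  -- are compared summand by summand.
  have key : (∑ s, q s * (-(X s).im + (2 * β s * (V s).re - 2 * p * Rv) * -(W s).im)) -
      (∑ s, q s * (- -(X s).im + (2 * β s * (W s).re - 2 * p * Rw) * -(V s).im)) =
      -2 * (∑ s, q s * ((X s).im + β s * ((V s).re * (W s).im + -(V s).im * (W s).re))) +
      ((∑ s, q s * (W s).im) * (2 * p * Rv) - (∑ s, q s * (V s).im) * (2 * p * Rw)) := by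
    rw [← hIv, ← hIw, ← Finset.sum_sub_distrib, ← Finset.sum_sub_distrib, Finset.mul_sum,
      ← Finset.sum_add_distrib]
    exact Finset.sum_congr rfl fun s _ => by ring
  linear_combination (-(1 / (4 * Real.pi)) * 2) * key

/-- An Euler identity: on the s-th block the vector (a_s z_s) is scaled by 1 + (p/a_s - 1) = p/a_s,
which cancels the weight a_s. -/
theorem sumMatrix_mulVec (ha : ∀ s, 0 < a s) {z : Cone r} (hz : ∀ s, z s ≠ 0) :
    (sumMatrix a r p z).mulVec (fun c => (a c.1 : ℂ) * flat z c) = (p : ℂ) • gradVec a r p z := by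
  funext c
  have h1 : (‖z c.1‖ : ℂ) ≠ 0 := by exact_mod_cast norm_ne_zero_iff.2 (hz c.1)
  have h3 : (a c.1 : ℂ) ≠ 0 := by exact_mod_cast (ha c.1).ne'
  have h4 : ∑ j, star (flat z ⟨c.1, j⟩) * ((a c.1 : ℂ) * flat z ⟨c.1, j⟩) =
      a c.1 * ((‖z c.1‖ ^ 2 : ℝ) : ℂ) := by
    rw [← sum_star_mul_self, Finset.mul_sum]
    exact Finset.sum_congr rfl fun j _ => by simp only [flat]; ring
  simp only [sumMatrix, blockMatrix_mulVec, h4, rankOneCoeff, gradVec, Pi.smul_apply, smul_eq_mul]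
  push_cast
  field_simp
  ring

/-- `det_minor_rank_one` for the Euler vector. Its i-th entry is a_i because z_i = 1, its pairing
with the gradient is ∑ |z_s|^{2p/a_s} / S = 1, and each block of M contributes q_s^{r_s} (1 + β_s
|z_s|²) = q_s^{r_s} p/a_s. -/
theorem det_leviMatrix_minor (ha : ∀ s, 0 < a s) (hp : 0 < p) {z : Cone r} (hz : ∀ s, z s ≠ 0)
    (i : Coord r) (hi : flat z i = 1) :
    ((leviMatrix a r p z).toSquareBlockProp (fun j => j ≠ i)).det =
      (((a i.1 : ℝ) ^ 2 / p * ∏ s, (radialCoeff a r p z s ^ r s * (p / a s)) : ℝ) : ℂ) := by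
  have hv := sumMatrix_mulVec (p := p) ha hz
  have key := det_minor_rank_one (sumMatrix a r p z) (gradVec a r p z)
    (fun c => (a c.1 : ℂ) * flat z c) p i hv (by
      have h := congrArg star hv
      rw [Matrix.star_mulVec, (sumMatrix_isHermitian z).eq] at h
      rw [h]
      ext c
      simp) (by
      rw [dotProduct, Fintype.sum_sigma]
      have h : ∀ s, ∑ j, star (gradVec a r p z) ⟨s, j⟩ * ((a s : ℂ) * flat z ⟨s, j⟩) =
          ((‖z s‖ ^ (2 * p / (a s : ℝ)) / radialSum a r p z : ℝ) : ℂ) := by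
        intro s
        have h1 : ‖z s‖ ≠ 0 := norm_ne_zero_iff.2 (hz s)
        have h3 : (a s : ℝ) ≠ 0 := by exact_mod_cast (ha s).ne'
        have : ∑ j, star (gradVec a r p z) ⟨s, j⟩ * ((a s : ℂ) * flat z ⟨s, j⟩) =
            (radialCoeff a r p z s : ℂ) * a s * ((‖z s‖ ^ 2 : ℝ) : ℂ) := by
          rw [← sum_star_mul_self, Finset.mul_sum]
          refine Finset.sum_congr rfl fun j _ => ?_
          simp [gradVec, flat]
          ring
        rw [this, radialCoeff]
        norm_cast
        have := radialSum_pos (a := a) (p := p) hz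
        field_simp
      simp only [h]
      rw [← Complex.ofReal_sum, ← Finset.sum_div]
      have := radialSum_pos (a := a) (p := p) hz
      rw [← radialSum, div_self this.ne', Complex.ofReal_one])
  have hp' : (p : ℂ) ≠ 0 := by exact_mod_cast hp.ne'
  change (p : ℂ) * ((leviMatrix a r p z).toSquareBlockProp (fun j => j ≠ i)).det = _ at key
  have hdet : (sumMatrix a r p z).det = ∏ s, ((radialCoeff a r p z s : ℂ) ^ r s * (p / a s)) := by
    rw [sumMatrix, blockMatrix_det]
    refine Finset.prod_congr rfl fun s _ => ?_
    congr 1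
    have h1 : (‖z s‖ : ℂ) ≠ 0 := by exact_mod_cast norm_ne_zero_iff.2 (hz s)
    have h4 : ∑ j, star (flat z ⟨s, j⟩) * flat z ⟨s, j⟩ = ((‖z s‖ ^ 2 : ℝ) : ℂ) :=
      sum_star_mul_self (z s)
    rw [h4, rankOneCoeff]
    push_cast
    field_simp
    ring
  rw [hdet, hi] at key
  push_cast
  apply mul_left_cancel₀ hp'
  rw [key, mul_one, ← mul_assoc, mul_div_cancel₀ _ hp', star_natCast, sq]

/-- The linear part of the slice. -/
def sliceLin (i : Coord r) : (i.Rest → ℂ) →ₗ[ℝ] Cone r where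
  toFun w := fun s => WithLp.toLp 2 fun j => if h : (⟨s, j⟩ : Coord r) = i then 0 else w ⟨⟨s, j⟩, h⟩
  map_add' v w := by
    funext s; ext j
    by_cases h : (⟨s, j⟩ : Coord r) = i <;> simp [h]
  map_smul' c w := by
    funext s; ext j
    by_cases h : (⟨s, j⟩ : Coord r) = i <;> simp [h]

theorem flat_sliceLin (i : Coord r) (w : i.Rest → ℂ) (c : Coord r) :
    flat (sliceLin i w) c = if h : c = i then 0 else w ⟨c, h⟩ := rfl

theorem flat_slice (i : Coord r) (w : i.Rest → ℂ) (c : Coord r) :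
    flat (slice i w) c = if h : c = i then 1 else w ⟨c, h⟩ := rfl

theorem slice_eq (i : Coord r) (w : i.Rest → ℂ) : slice i w = sliceLin i w + slice i 0 := by
  funext s; ext j
  by_cases h : (⟨s, j⟩ : Coord r) = i <;> simp [slice, sliceLin, h]

theorem fderiv_slice (i : Coord r) (w : i.Rest → ℂ) :
    fderiv ℝ (slice i) w = LinearMap.toContinuousLinearMap (sliceLin i) := by
  have : slice i = fun w => LinearMap.toContinuousLinearMap (sliceLin i) w + slice i 0 :=
    funext fun w => slice_eq i w
  rw [this]
  exact ((LinearMap.toContinuousLinearMap (sliceLin i)).hasFDerivAt.add_const _).fderiv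

theorem continuous_slice (i : Coord r) : Continuous (slice i) := by
  have : slice i = fun w => LinearMap.toContinuousLinearMap (sliceLin i) w + slice i 0 :=
    funext fun w => slice_eq i w
  rw [this]
  exact (LinearMap.toContinuousLinearMap (sliceLin i)).continuous.add continuous_const

/-- Tangent vectors of the slice have i-th coordinate 0, so restricting a Hermitian form to the
slice deletes row and column i. -/
theorem dotProduct_sliceLin (i : Coord r) (H : Matrix (Coord r) (Coord r) ℂ) (v w : i.Rest → ℂ) :
    star (flat (sliceLin i v)) ⬝ᵥ H.mulVec (flat (sliceLin i w)) =
      star v ⬝ᵥ (H.toSquareBlockProp (fun j => j ≠ i)).mulVec w := by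
  have key : ∀ g : Coord r → ℂ, g i = 0 → ∑ c, g c = ∑ c : i.Rest, g c := by
    intro g hg
    rw [← Finset.sum_subtype (Finset.univ.erase i) (by simp) g,
      ← Finset.add_sum_erase _ _ (Finset.mem_univ i), hg, zero_add]
  rw [dotProduct, key _ (by simp [flat_sliceLin])]
  refine Finset.sum_congr rfl fun c _ => ?_
  congr 1
  · simp [flat_sliceLin, c.2]
  · rw [Matrix.mulVec, dotProduct, key _ (by simp [flat_sliceLin])]
    refine Finset.sum_congr rfl fun d _ => ?_
    simp [flat_sliceLin, d.2, Matrix.toSquareBlockProp_def]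

theorem wedgePow_chartForm (ha : ∀ s, 0 < a s) (hp : 0 < p) (i : Coord r) (w : i.Rest → ℂ)
    (hz : ∀ s, slice i w s ≠ 0) :
    wedgePow (chartForm (kahlerForm a r p) i w) (stdFrame i.Rest) =
      (((∑ s, r s) - 1).factorial : ℝ) * (1 / Real.pi) ^ ((∑ s, r s) - 1) *
        ((a i.1 : ℝ) ^ 2 / p * ∏ s, (radialCoeff a r p (slice i w) s ^ r s * (p / a s))) := by
  rw [wedgePow_of_isHermitian _ (1 / Real.pi)
    ((leviMatrix a r p (slice i w)).toSquareBlockProp (fun j => j ≠ i)), card_rest,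
    det_leviMatrix_minor ha hp hz i (slice_self i w), Complex.ofReal_re]
  · exact (leviMatrix_isHermitian _).submatrix _
  · intro v u
    rw [← dotProduct_sliceLin, ← ddc_potential ha hp hz, chartForm, fderiv_slice,
      ContinuousAlternatingMap.compContinuousLinearMap_apply, kahlerForm]
    congr 1
    funext k; fin_cases k <;> rfl

end Levi

/-! ### Densities and rearrangements of finite product measures -/

section ProductMeasures

theorem lintegral_fin_prod_eq_prod {n : ℕ} {E : Type*} [MeasurableSpace E]
    {μ : Fin n → Measure E} [∀ i, SigmaFinite (μ i)]
    (f : Fin n → E → ENNReal) (hf : ∀ i, Measurable (f i)) :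
    ∫⁻ x : Fin n → E, ∏ i, f i (x i) ∂(Measure.pi μ) = ∏ i, ∫⁻ x, f i x ∂(μ i) := by
  induction n with
  | zero => simp
  | succ n ih =>
    have hm : Measurable fun x : Fin (n + 1) → E => ∏ i, f i (x i) :=
      Finset.measurable_prod _ fun i _ => (hf i).comp (measurable_pi_apply i)
    rw [← ((measurePreserving_piFinSuccAbove μ 0).symm).lintegral_comp hm, Fin.prod_univ_succ,
      ← ih (fun i => f i.succ) fun i => hf i.succ, ← lintegral_prod_mul (hf 0).aemeasurable
      (Finset.measurable_prod _ fun i _ =>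
        (hf i.succ).comp (measurable_pi_apply i)).aemeasurable]
    refine lintegral_congr fun x => ?_
    rw [Fin.prod_univ_succ]
    rfl

theorem pi_withDensity {n : ℕ} {E : Type*} [MeasurableSpace E]
    {μ : Fin n → Measure E} [∀ i, SigmaFinite (μ i)]
    (f : Fin n → E → ENNReal) (hf : ∀ i, Measurable (f i))
    [∀ i, SigmaFinite ((μ i).withDensity (f i))] :
    Measure.pi (fun i => (μ i).withDensity (f i)) =
      (Measure.pi μ).withDensity fun x => ∏ i, f i (x i) := by
  refine Measure.pi_eq fun s hs => ?_
  rw [withDensity_apply _ (MeasurableSet.univ_pi hs), ← lintegral_indicator (MeasurableSet.univ_pi hs)]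
  have : (fun x : Fin n → E => (Set.univ.pi s).indicator (fun x => ∏ i, f i (x i)) x) =
      fun x => ∏ i, (s i).indicator (f i) (x i) := by
    funext x
    by_cases hx : x ∈ Set.univ.pi s
    · rw [Set.indicator_of_mem hx]
      exact Finset.prod_congr rfl fun i _ => (Set.indicator_of_mem (hx i trivial) _).symm
    · rw [Set.indicator_of_notMem hx]
      simp only [Set.mem_univ_pi, not_forall] at hx
      obtain ⟨i, hi⟩ := hx
      exact (Finset.prod_eq_zero (Finset.mem_univ i) (Set.indicator_of_notMem hi _)).symm
  rw [this, lintegral_fin_prod_eq_prod _ fun i => (hf i).indicator (hs i)]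
  exact Finset.prod_congr rfl fun i _ => by
    rw [lintegral_indicator (hs i), withDensity_apply _ (hs i)]

open Measure in
theorem pi_prod_eq_map {ι : Type*} [Fintype ι] {α β : ι → Type*}
    [∀ i, MeasurableSpace (α i)] [∀ i, MeasurableSpace (β i)]
    (μ : (i : ι) → Measure (α i)) (ν : (i : ι) → Measure (β i)) [∀ i, SigmaFinite (μ i)]
    [∀ i, SigmaFinite (ν i)] :
    Measure.map (fun (x : ((i : ι) → α i) × ((i : ι) → β i)) i => (x.1 i, x.2 i))
      ((Measure.pi μ).prod (Measure.pi ν)) = Measure.pi fun i => (μ i).prod (ν i) := by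
  have hm : Measurable fun (x : ((i : ι) → α i) × ((i : ι) → β i)) (i : ι) => (x.1 i, x.2 i) := by
    fun_prop
  refine (Measure.pi_eq_generateFrom (C := fun i =>
    Set.image2 (· ×ˢ ·) {s : Set (α i) | MeasurableSet s} {t : Set (β i) | MeasurableSet t})
    (fun i => generateFrom_prod) (fun i => isPiSystem_prod)
    (fun i => (μ i).toFiniteSpanningSetsIn.prod (ν i).toFiniteSpanningSetsIn) fun s hs => ?_).symm
  choose A hA B hB hAB using hs
  obtain rfl : s = fun i => A i ×ˢ B i := funext fun i => (hAB i).symm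
  rw [map_apply hm (MeasurableSet.univ_pi fun i => (hA i).prod (hB i))]
  rw [show (fun (x : ((i : ι) → α i) × ((i : ι) → β i)) (i : ι) => (x.1 i, x.2 i)) ⁻¹'
      (Set.univ.pi fun i => A i ×ˢ B i) = Set.univ.pi A ×ˢ Set.univ.pi B by
    ext; simp [Set.mem_pi, forall_and]]
  simp_rw [prod_prod, pi_pi, Finset.prod_mul_distrib]

end ProductMeasures

/-! ### Power substitutions and Gamma integrals on the half-line -/

section OneDimensional

theorem lintegral_Ioi_comp_rpow {α : ℝ} (hα : 0 < α) (f : ℝ → ENNReal) :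
    ∫⁻ y in Set.Ioi 0, f y = ∫⁻ h in Set.Ioi 0, ENNReal.ofReal (α * h ^ (α - 1)) * f (h ^ α) := by
  have himg : (fun h : ℝ => h ^ α) '' Set.Ioi 0 = Set.Ioi 0 := by
    ext y
    constructor
    · rintro ⟨h, hh, rfl⟩
      exact Real.rpow_pos_of_pos hh _
    · intro hy
      exact ⟨y ^ (1 / α), Real.rpow_pos_of_pos hy _, by
        simp only
        rw [← Real.rpow_mul (le_of_lt hy), one_div_mul_cancel hα.ne', Real.rpow_one]⟩
  have h := lintegral_image_eq_lintegral_abs_deriv_mul (s := Set.Ioi 0) (f := fun h : ℝ => h ^ α)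
    (f' := fun h => α * h ^ (α - 1)) measurableSet_Ioi
    (fun x hx => (Real.hasDerivAt_rpow_const (Or.inl (ne_of_gt hx))).hasDerivWithinAt)
    (fun x hx y hy hxy => Real.rpow_left_injOn hα.ne' (Set.mem_Ioi.1 hx).le (Set.mem_Ioi.1 hy).le hxy) f
  rw [himg] at h
  rw [h]
  refine setLIntegral_congr_fun measurableSet_Ioi fun x hx => ?_
  have hx' : (0 : ℝ) < x := hx
  rw [abs_of_nonneg (by positivity)]

/-- Equivalent to the total mass 1 of the Gamma distribution with shape n + 1 and rate S. -/
theorem lintegral_Ioi_pow_mul_exp (n : ℕ) {S : ℝ} (hS : 0 < S) :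
    ∫⁻ h in Set.Ioi 0, ENNReal.ofReal (h ^ n * Real.exp (-(S * h))) =
      ENNReal.ofReal (n.factorial / S ^ (n + 1)) := by
  have h1 := ProbabilityTheory.lintegral_gammaPDF_eq_one (a := n + 1) (r := S) (by positivity) hS
  have h2 : ∫⁻ x, ProbabilityTheory.gammaPDF (n + 1) S x =
      ENNReal.ofReal (S ^ (n + 1) / n.factorial) *
        ∫⁻ h in Set.Ioi 0, ENNReal.ofReal (h ^ n * Real.exp (-(S * h))) := by
    rw [← lintegral_const_mul _ (by fun_prop), ← lintegral_indicator measurableSet_Ioi]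
    refine lintegral_congr_ae ?_
    filter_upwards [(Measure.ae_ne volume (0 : ℝ))] with x hx
    rw [ProbabilityTheory.gammaPDF, ProbabilityTheory.gammaPDFReal]
    by_cases h0 : 0 < x
    · rw [if_pos h0.le, Set.indicator_of_mem (by exact h0), ← ENNReal.ofReal_mul (by positivity),
        Real.Gamma_nat_eq_factorial, add_sub_cancel_right, Real.rpow_natCast, mul_assoc]
      congr 3
      exact_mod_cast Real.rpow_natCast S (n + 1)
    · rw [if_neg (by grind), Set.indicator_of_notMem (by exact h0), ENNReal.ofReal_zero]
  rw [h1] at h2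
  have hpos : 0 < S ^ (n + 1) / n.factorial := by positivity
  rw [← inv_div, ENNReal.ofReal_inv_of_pos hpos]
  exact ENNReal.eq_inv_of_mul_eq_one_left (by rw [mul_comm]; exact h2.symm)

end OneDimensional

/-! ### Polar coordinates for nonnegative integrals -/

section Polar

variable {E : Type*} [NormedAddCommGroup E] [NormedSpace ℝ E] [MeasurableSpace E] [BorelSpace E]
  [FiniteDimensional ℝ E] [Nontrivial E]

theorem lintegral_polar (μ : Measure E) [μ.IsAddHaarMeasure] (K : E → ENNReal) (hK : Measurable K) :
    ∫⁻ z, K z ∂μ = ∫⁻ y in Set.Ioi (0 : ℝ), ENNReal.ofReal (y ^ (Module.finrank ℝ E - 1)) *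
      ∫⁻ u : Metric.sphere (0 : E) 1, K (y • (u : E)) ∂μ.toSphere := by
  have h1 : ∫⁻ z, K z ∂μ = ∫⁻ z : ({0}ᶜ : Set E), K z ∂(μ.comap Subtype.val) := by
    rw [lintegral_subtype_comap (measurableSet_singleton _).compl, restrict_compl_singleton]
  have h2 := (μ.measurePreserving_homeomorphUnitSphereProd.symm
    (homeomorphUnitSphereProd E).toMeasurableEquiv).lintegral_comp
    (f := fun z : ({0}ᶜ : Set E) => K z) (hK.comp measurable_subtype_coe)
  have h3 : Measurable fun x : Metric.sphere (0 : E) 1 × Set.Ioi (0 : ℝ) =>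
      K ((x.2 : ℝ) • (x.1 : E)) := hK.comp (by fun_prop)
  rw [h1, ← h2]
  have h4 : ∀ x : Metric.sphere (0 : E) 1 × Set.Ioi (0 : ℝ),
      (((homeomorphUnitSphereProd E).toMeasurableEquiv.symm x : ({0}ᶜ : Set E)) : E) =
      (x.2 : ℝ) • (x.1 : E) := homeomorphUnitSphereProd_symm_apply_coe E
  simp only [h4]
  rw [lintegral_prod_symm _ h3.aemeasurable, Measure.volumeIoiPow]
  rw [lintegral_withDensity_eq_lintegral_mul _ (by fun_prop) h3.lintegral_prod_left']
  simp only [Pi.mul_apply]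
  rw [lintegral_subtype_comap measurableSet_Ioi (fun y : ℝ =>
    ENNReal.ofReal (y ^ (Module.finrank ℝ E - 1)) *
      ∫⁻ u : Metric.sphere (0 : E) 1, K (y • (u : E)) ∂μ.toSphere)]

end Polar

/-! ### The positive orthant as a cone over the simplex -/

section ConeCoordinates

theorem measurable_simplexPoint (m : ℕ) : Measurable (simplexPoint (m := m)) := by
  refine measurable_pi_lambda _ fun s => ?_
  refine Fin.lastCases ?_ (fun j => ?_) s
  · simp only [simplexPoint, Fin.snoc_last]
    fun_prop
  · simp only [simplexPoint, Fin.snoc_castSucc]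
    fun_prop

theorem sum_simplexPoint {m : ℕ} (y : Fin m → ℝ) : ∑ s, simplexPoint y s = 1 := by
  simp [simplexPoint, Fin.sum_univ_castSucc]

theorem lintegral_simplexMeasure {m : ℕ} (K : (Fin (m + 1) → ℝ) → ENNReal) (hK : Measurable K) :
    ∫⁻ x, K x ∂simplexMeasure m =
      ∫⁻ y : Fin m → ℝ, {x : Fin (m + 1) → ℝ | ∀ s, 0 ≤ x s}.indicator K (simplexPoint y) := by
  have hm := measurable_simplexPoint m
  have hs : MeasurableSet {x : Fin (m + 1) → ℝ | ∀ s, 0 ≤ x s} := by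
    simp only [Set.ofPred_forall]
    exact MeasurableSet.iInter fun s => measurableSet_le measurable_const (measurable_pi_apply s)
  have hset : {y : Fin m → ℝ | simplexPoint y ∈ stdSimplex ℝ (Fin (m + 1))} =
      simplexPoint ⁻¹' {x : Fin (m + 1) → ℝ | ∀ s, 0 ≤ x s} := by
    ext y
    simp [stdSimplex, sum_simplexPoint]
  rw [simplexMeasure, lintegral_map hK hm, hset, ← lintegral_indicator (hm hs)]
  rfl

/-- A shear replaces the last coordinate by the total S, and scaling the other m coordinates by S
produces the factor S^m. No Jacobian of a nonlinear map is needed. -/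
theorem lintegral_cone_coordinates {m : ℕ} (K : (Fin (m + 1) → ℝ) → ENNReal) (hK : Measurable K) :
    ∫⁻ h, K h ∂(Measure.pi fun _ : Fin (m + 1) => (volume : Measure ℝ).restrict (Set.Ioi 0)) =
      ∫⁻ S in Set.Ioi (0 : ℝ), ENNReal.ofReal (S ^ m) * ∫⁻ x, K (S • x) ∂simplexMeasure m := by
  set O : Set (Fin (m + 1) → ℝ) := {x | ∀ s, 0 ≤ x s} with hO
  have hs : MeasurableSet O := by
    simp only [hO, Set.ofPred_forall]
    exact MeasurableSet.iInter fun s => measurableSet_le measurable_const (measurable_pi_apply s)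
  set G := O.indicator K with hG
  have hGm : Measurable G := hK.indicator hs
  have h1 : ∫⁻ h, K h ∂(Measure.pi fun _ : Fin (m + 1) => (volume : Measure ℝ).restrict (Set.Ioi 0))
      = ∫⁻ h, G h := by
    rw [hG, lintegral_indicator hs]
    have : O = Set.univ.pi fun _ => Set.Ici 0 := by ext; simp [hO, Pi.le_def]
    rw [this, volume_pi, Measure.restrict_pi_pi]
    simp only [restrict_Ioi_eq_restrict_Ici]
  have hsn : Measurable fun x : (Fin m → ℝ) × ℝ => (Fin.snoc (α := fun _ => ℝ) x.1 x.2) := by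
    refine measurable_pi_lambda _ fun s => ?_
    refine Fin.lastCases ?_ (fun j => ?_) s
    · simp only [Fin.snoc_last]; fun_prop
    · simp only [Fin.snoc_castSucc]; fun_prop
  have h2 : ∫⁻ h, G h = ∫⁻ y : Fin m → ℝ, ∫⁻ t : ℝ, G (Fin.snoc (α := fun _ => ℝ) y t) := by
    rw [← ((volume_preserving_piFinSuccAbove (fun _ : Fin (m + 1) => ℝ) (Fin.last m)).symm).lintegral_comp
      hGm]
    simp only [MeasurableEquiv.piFinSuccAbove_symm_apply, Fin.insertNthEquiv, Equiv.coe_fn_mk,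
      Fin.insertNth_last']
    rw [Measure.volume_eq_prod, lintegral_prod_symm _ (by
      exact (hGm.comp (hsn.comp measurable_swap)).aemeasurable)]
  -- For fixed y, the substitution t = S - ∑ y_i is a translation.
  have h3 : ∫⁻ y : Fin m → ℝ, ∫⁻ t : ℝ, G (Fin.snoc (α := fun _ => ℝ) y t) =
      ∫⁻ S : ℝ, ∫⁻ y : Fin m → ℝ, G (Fin.snoc (α := fun _ => ℝ) y (S - ∑ i, y i)) := by
    rw [lintegral_lintegral_swap (f := fun (S : ℝ) (y : Fin m → ℝ) =>
      G (Fin.snoc (α := fun _ => ℝ) y (S - ∑ i, y i)))]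
    · refine lintegral_congr fun y => ?_
      exact (lintegral_sub_right_eq_self (fun t => G (Fin.snoc (α := fun _ => ℝ) y t)) _).symm
    · exact (hGm.comp (hsn.comp (by fun_prop :
        Measurable fun x : ℝ × (Fin m → ℝ) => (x.2, x.1 - ∑ i, x.2 i)))).aemeasurable
  have h4 : ∀ S < 0, ∫⁻ y : Fin m → ℝ, G (Fin.snoc (α := fun _ => ℝ) y (S - ∑ i, y i)) = 0 := by
    intro S hS
    refine (lintegral_congr fun y => ?_).trans lintegral_zero
    refine Set.indicator_of_notMem (fun hy => ?_) _
    have : 0 ≤ ∑ s, (Fin.snoc (α := fun _ => ℝ) y (S - ∑ i, y i) : Fin (m + 1) → ℝ) s :=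
      Finset.sum_nonneg fun s _ => hy s
    rw [Fin.sum_univ_castSucc] at this
    simp at this
    linarith
  rw [h1, h2, h3, ← lintegral_indicator measurableSet_Ioi]
  refine lintegral_congr_ae ?_
  filter_upwards [Measure.ae_ne volume (0 : ℝ)] with S hS0
  by_cases hS : 0 < S
  · rw [Set.indicator_of_mem (by exact hS), lintegral_simplexMeasure (fun x => K (S • x))
      (hK.comp (measurable_const_smul S))]
    have hsc := Measure.map_addHaar_smul (volume : Measure (Fin m → ℝ)) hS0
    have hmeas : Measurable fun y : Fin m → ℝ =>
        G (Fin.snoc (α := fun _ => ℝ) y (S - ∑ i, y i)) :=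
      hGm.comp (hsn.comp (by fun_prop : Measurable fun y : Fin m → ℝ => (y, S - ∑ i, y i)))
    have h5 := lintegral_map (μ := (volume : Measure (Fin m → ℝ))) hmeas
      (measurable_const_smul S)
    rw [hsc, lintegral_smul_measure, Module.finrank_fin_fun] at h5
    have h6 : ∀ y : Fin m → ℝ, G (Fin.snoc (α := fun _ => ℝ) (S • y) (S - ∑ i, (S • y) i)) =
        O.indicator (fun x => K (S • x)) (simplexPoint y) := by
      intro y
      have e : (Fin.snoc (α := fun _ => ℝ) (S • y) (S - ∑ i, (S • y) i) : Fin (m + 1) → ℝ) =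
          S • simplexPoint y := by
        funext s
        refine Fin.lastCases ?_ (fun j => ?_) s
        · simp [simplexPoint, mul_sub, Finset.mul_sum]
        · simp [simplexPoint]
      rw [e, hG]
      have hmem : S • simplexPoint y ∈ O ↔ simplexPoint y ∈ O := by
        simp [hO, hS]
      by_cases hx : simplexPoint y ∈ O
      · rw [Set.indicator_of_mem hx, Set.indicator_of_mem (hmem.2 hx)]
      · rw [Set.indicator_of_notMem hx, Set.indicator_of_notMem (fun h => hx (hmem.1 h))]
    simp only [h6] at h5
    rw [← h5, smul_eq_mul, ← mul_assoc, ← ENNReal.ofReal_mul (by positivity),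
      abs_of_pos (by positivity), mul_inv_cancel₀ (by positivity), ENNReal.ofReal_one, one_mul]
  · rw [Set.indicator_of_notMem (by exact hS), h4 S (by grind)]

end ConeCoordinates

/-! ### Lebesgue measure on ℂ^N in scalar coordinates and along the orbits of a slice -/

section Volume

theorem finrank_euclidean_complex (n : ℕ) :
    Module.finrank ℝ (EuclideanSpace ℂ (Fin n)) = 2 * n := by
  rw [← Module.finrank_mul_finrank ℝ ℂ (EuclideanSpace ℂ (Fin n))]
  simp

/-- Both measures are Haar, hence proportional, and the Euclidean unit ball has volume π^n/n! for
each of them. -/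
theorem volume_preserving_toLp_complex (n : ℕ) :
    MeasurePreserving (WithLp.toLp 2 : (Fin n → ℂ) → EuclideanSpace ℂ (Fin n)) := by
  -- In dimension 0 both measures are the unit mass at the only point; the ball volume formulas are
  -- used only for n > 0.
  rcases Nat.eq_zero_or_pos n with rfl | hn
  · refine ⟨WithLp.measurable_toLp _ _, ?_⟩
    have h1 : (volume : Measure (EuclideanSpace ℂ (Fin 0))) = Measure.dirac 0 := by
      have b : OrthonormalBasis (Fin 0) ℝ (EuclideanSpace ℂ (Fin 0)) :=
        (stdOrthonormalBasis ℝ _).reindex (finCongr (by simp [finrank_euclidean_complex]))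
      rw [← b.measurePreserving_repr_symm.map_eq, volume_euclideanSpace_eq_dirac,
        Measure.map_dirac' b.measurePreserving_repr_symm.measurable]
      simp
    rw [h1, volume_pi, Measure.pi_of_empty _ 0, Measure.map_dirac' (WithLp.measurable_toLp _ _)]
    exact congrArg _ (Subsingleton.elim _ _)
  have : Nonempty (Fin n) := ⟨⟨0, hn⟩⟩
  have : Nontrivial (EuclideanSpace ℂ (Fin n)) :=
    (WithLp.toLp_injective 2 (V := Fin n → ℂ)).nontrivial
  have hm : Measurable (WithLp.toLp 2 : (Fin n → ℂ) → EuclideanSpace ℂ (Fin n)) :=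
    WithLp.measurable_toLp _ _
  refine ⟨hm, ?_⟩
  set L := (PiLp.continuousLinearEquiv 2 ℝ (fun _ : Fin n => ℂ)).symm with hL
  have hmap : Measure.map (WithLp.toLp 2 : (Fin n → ℂ) → EuclideanSpace ℂ (Fin n)) volume =
      Measure.map L volume := rfl
  have hH : (Measure.map L (volume : Measure (Fin n → ℂ))).IsAddHaarMeasure :=
    L.isAddHaarMeasure_map volume
  obtain ⟨c, hu⟩ : ∃ c : NNReal, Measure.map L (volume : Measure (Fin n → ℂ)) =
      c • (volume : Measure (EuclideanSpace ℂ (Fin n))) :=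
    ⟨_, Measure.isAddLeftInvariant_eq_smul _ _⟩
  rw [← hmap] at hu
  have hball : (Measure.map (WithLp.toLp 2 : (Fin n → ℂ) → EuclideanSpace ℂ (Fin n)) volume)
      (Metric.ball 0 1) = ENNReal.ofReal (Real.pi ^ n / n.factorial) := by
    rw [Measure.map_apply hm Metric.isOpen_ball.measurableSet]
    have := Complex.volume_sum_rpow_lt_one (Fin n) (p := 2) (by norm_num)
    have e : (WithLp.toLp 2 : (Fin n → ℂ) → EuclideanSpace ℂ (Fin n)) ⁻¹' Metric.ball 0 1 =
        {x | ∑ i, ‖x i‖ ^ (2 : ℝ) < 1} := by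
      ext x
      simp only [Set.mem_preimage, Metric.mem_ball, dist_zero_right, Set.mem_ofPred_eq]
      rw [EuclideanSpace.norm_eq, Real.sqrt_lt' one_pos]
      simp
    rw [e, this]
    congr 1
    rw [Fintype.card_fin]
    have h2 : (2 : ℝ) * n / 2 + 1 = n + 1 := by ring
    rw [h2, Real.Gamma_nat_eq_factorial]
    norm_num
  have hball2 : (volume : Measure (EuclideanSpace ℂ (Fin n))) (Metric.ball 0 1) =
      ENNReal.ofReal (Real.pi ^ n / n.factorial) := by
    rw [InnerProductSpace.volume_ball_of_dim_even (finrank_euclidean_complex n)]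
    simp
  have hc := congrArg (fun μ => μ (Metric.ball 0 1)) hu
  simp only [Measure.smul_apply, hball, hball2] at hc
  have hpos : ENNReal.ofReal (Real.pi ^ n / n.factorial) ≠ 0 := by
    have := Real.pi_pos
    rw [Ne, ENNReal.ofReal_eq_zero, not_le]; positivity
  have hc1 : (c : ENNReal) = 1 := by
    have h1 : (1 : ENNReal) * ENNReal.ofReal (Real.pi ^ n / n.factorial) =
      c * ENNReal.ofReal (Real.pi ^ n / n.factorial) := by rw [one_mul]; exact hc
    exact ((ENNReal.mul_left_inj hpos ENNReal.ofReal_ne_top).1 h1).symm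
  have hc2 : c = 1 := by exact_mod_cast hc1
  rw [hu, hc2, one_smul]

variable {m : ℕ} {a r : Fin (m + 1) → ℕ} {p : ℝ}

/-- The point with given scalar coordinates. -/
def unflat (g : Coord r → ℂ) : Cone r := fun s => WithLp.toLp 2 fun j => g ⟨s, j⟩

theorem measurable_unflat : Measurable (unflat (r := r)) :=
  measurable_pi_lambda _ fun _ => (WithLp.measurable_toLp _ _).comp
    (measurable_pi_lambda _ fun _ => measurable_pi_apply _)

theorem volume_preserving_flat : MeasurePreserving (flat (r := r)) := by
  have hm : Measurable (flat (r := r)) :=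
    measurable_pi_lambda _ fun c => (measurable_pi_apply c.2).comp
      ((WithLp.measurable_ofLp 2 (Fin (r c.1) → ℂ)).comp (measurable_pi_apply c.1))
  refine ⟨hm, (Measure.pi_eq fun B hB => ?_).symm⟩
  rw [Measure.map_apply hm (MeasurableSet.univ_pi hB)]
  have hset : flat (r := r) ⁻¹' Set.univ.pi B = Set.univ.pi fun s =>
      (WithLp.ofLp : EuclideanSpace ℂ (Fin (r s)) → (Fin (r s) → ℂ)) ⁻¹'
        Set.univ.pi fun j => B ⟨s, j⟩ := by
    ext z
    simp only [Set.mem_preimage, Set.mem_univ_pi]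
    exact ⟨fun h s j => h ⟨s, j⟩, fun h c => h c.1 c.2⟩
  rw [hset, volume_pi, Measure.pi_pi, Fintype.prod_sigma]
  refine Finset.prod_congr rfl fun s _ => ?_
  have hms : MeasurableSet (Set.univ.pi fun j => B ⟨s, j⟩) := MeasurableSet.univ_pi fun j => hB _
  rw [← (volume_preserving_toLp_complex (r s)).measure_preimage
    ((WithLp.measurable_ofLp _ _) hms).nullMeasurableSet]
  exact Measure.pi_pi _ _

theorem lintegral_cone_eq (K : Cone r → ENNReal) (hK : Measurable K) :
    ∫⁻ z, K z = ∫⁻ g : Coord r → ℂ, K (unflat g) :=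
  (volume_preserving_flat.lintegral_comp (f := fun g => K (unflat g))
    (hK.comp measurable_unflat))

/-- The point of `ℂ^{Coord}` with `i`-th coordinate `ζ` and other coordinates `w`. -/
def joinCoord (i : Coord r) (x : ℂ × (i.Rest → ℂ)) (c : Coord r) : ℂ :=
  if h : c = i then x.1 else x.2 ⟨c, h⟩

theorem prod_coord_eq {M : Type*} [CommMonoid M] (i : Coord r) (g : Coord r → M) :
    ∏ c, g c = g i * ∏ c : i.Rest, g c := by
  rw [← Finset.prod_subtype (Finset.univ.erase i) (by simp) g,
    Finset.mul_prod_erase _ _ (Finset.mem_univ i)]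

theorem volume_preserving_joinCoord (i : Coord r) : MeasurePreserving (joinCoord i) := by
  have hm : Measurable (joinCoord i) := by
    refine measurable_pi_lambda _ fun c => ?_
    unfold joinCoord
    split_ifs with h
    · exact measurable_fst
    · exact (measurable_pi_apply _).comp measurable_snd
  refine ⟨hm, (Measure.pi_eq fun B hB => ?_).symm⟩
  rw [Measure.map_apply hm (MeasurableSet.univ_pi hB)]
  have hset : joinCoord i ⁻¹' Set.univ.pi B = B i ×ˢ Set.univ.pi fun c : i.Rest => B c := by
    ext x
    simp only [Set.mem_preimage, Set.mem_univ_pi, Set.mem_prod, joinCoord]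
    constructor
    · intro h
      exact ⟨by simpa using h i, fun c => by simpa [c.2] using h c⟩
    · rintro ⟨h1, h2⟩ c
      split_ifs with h
      · rw [h]; exact h1
      · exact h2 ⟨c, h⟩
  rw [hset, Measure.volume_eq_prod, Measure.prod_prod, volume_pi, Measure.pi_pi, prod_coord_eq i]

/-- The real Jacobian of multiplication by d_c on ℂ is |d_c|². -/
theorem lintegral_diagonal {ι : Type*} [Fintype ι] (d : ι → ℂ) (hd : ∀ c, d c ≠ 0)
    (F : (ι → ℂ) → ENNReal) (hF : Measurable F) :
    ∫⁻ w, F w = ENNReal.ofReal (∏ c, ‖d c‖ ^ 2) * ∫⁻ w : ι → ℂ, F (fun c => d c * w c) := by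
  classical
  set f : (ι → ℂ) →ₗ[ℝ] (ι → ℂ) := (Matrix.toLin' (Matrix.diagonal d)).restrictScalars ℝ with hf
  have hfd : LinearMap.det f = ∏ c, ‖d c‖ ^ 2 := by
    rw [hf, LinearMap.det_restrictScalars, LinearMap.det_toLin', Matrix.det_diagonal,
      Algebra.norm_complex_apply, map_prod]
    simp only [Complex.normSq_eq_norm_sq]
  have hpos : 0 < ∏ c, ‖d c‖ ^ 2 := Finset.prod_pos fun c _ => by
    have := norm_pos_iff.2 (hd c); positivity
  have h := Measure.map_linearMap_addHaar_eq_smul_addHaar (volume : Measure (ι → ℂ))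
    (f := f) (by rw [hfd]; exact hpos.ne')
  have hfm : Measurable f := f.continuous_of_finiteDimensional.measurable
  have h2 := lintegral_map (μ := (volume : Measure (ι → ℂ))) hF hfm
  rw [h, lintegral_smul_measure, hfd] at h2
  have h3 : ∀ w, f w = fun c => d c * w c := by
    intro w; funext c; simp [hf, Matrix.mulVec_diagonal]
  simp only [h3] at h2
  rw [← h2, smul_eq_mul, ← mul_assoc, ← ENNReal.ofReal_mul hpos.le, abs_of_pos (by positivity),
    mul_inv_cancel₀ hpos.ne', ENNReal.ofReal_one, one_mul]

theorem flat_act (t : ℂ) (z : Cone r) (c : Coord r) : flat (act a r t z) c = t ^ a c.1 * flat z c := by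
  simp [flat, act]

theorem flat_injective : Function.Injective (flat (r := r)) := by
  intro z w h
  funext s; ext j
  exact congrFun h ⟨s, j⟩

theorem flat_unflat (g : Coord r → ℂ) : flat (unflat g) = g := rfl

theorem measurable_act (t : ℂ) : Measurable (act a r t) := by
  unfold act
  exact measurable_pi_lambda _ fun s =>
    (measurable_const_smul (t ^ a s)).comp (measurable_pi_apply s)

/-- Integration over `ℂ^{|r|}` in the coordinates `(ζ, w) ↦ ζ^{1/a_i} · slice w`. -/
theorem lintegral_cone_slice (ha : ∀ s, 0 < a s) (i : Coord r) (K : Cone r → ENNReal)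
    (hK : Measurable K) :
    ∫⁻ z, K z = ∫⁻ ζ : ℂ, ENNReal.ofReal (‖ζ ^ (1 / (a i.1 : ℂ))‖ ^ (2 * ∑ s, r s * a s) / ‖ζ‖ ^ 2) *
      ∫⁻ w, K (act a r (ζ ^ (1 / (a i.1 : ℂ))) (slice i w)) := by
  rw [lintegral_cone_eq K hK, ← (volume_preserving_joinCoord i).lintegral_comp
    (f := fun g => K (unflat g)) (hK.comp measurable_unflat), Measure.volume_eq_prod, lintegral_prod
    (fun x => K (unflat (joinCoord i x))) ((hK.comp measurable_unflat).comp (volume_preserving_joinCoord i).measurable).aemeasurable]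
  refine lintegral_congr_ae ?_
  filter_upwards [Measure.ae_ne volume (0 : ℂ)] with ζ hζ
  -- Any root with τ^{a_i} = ζ would do. Since ζ is fixed while w varies, the discontinuity of the
  -- principal branch plays no role.
  set τ := ζ ^ (1 / (a i.1 : ℂ)) with hτ
  have hai : (a i.1 : ℂ) ≠ 0 := by exact_mod_cast (ha i.1).ne'
  have hτi : τ ^ a i.1 = ζ := by
    rw [hτ, one_div]
    exact Complex.cpow_nat_inv_pow ζ (ha i.1).ne'
  have hτ0 : τ ≠ 0 := by
    intro h
    rw [h, zero_pow (ha i.1).ne'] at hτi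
    exact hζ hτi.symm
  have hmeas : Measurable fun w : i.Rest → ℂ => K (unflat (joinCoord i (ζ, w))) :=
    (hK.comp measurable_unflat).comp ((volume_preserving_joinCoord i).measurable.comp
      measurable_prodMk_left)
  -- Substitute τ^{a_c} w_c for the coordinates c ≠ i. The Jacobian is |τ|^{2 ∑ r_s a_s} without the
  -- factor of the coordinate i, which is |τ^{a_i}|² = |ζ|².
  rw [lintegral_diagonal (fun c : i.Rest => τ ^ a c.1.1) (fun c => pow_ne_zero _ hτ0) _ hmeas]
  congr 1
  · congr 1
    have h1 : ∏ c : Coord r, ‖τ ^ a c.1‖ ^ 2 = ‖τ‖ ^ (2 * ∑ s, r s * a s) := by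
      rw [Fintype.prod_sigma]
      simp only [Finset.prod_const, Finset.card_univ, Fintype.card_fin, norm_pow, ← pow_mul]
      rw [Finset.prod_pow_eq_pow_sum, Finset.mul_sum]
      congr 1
      exact Finset.sum_congr rfl fun s _ => by ring
    rw [prod_coord_eq i, hτi] at h1
    have : ‖ζ‖ ≠ 0 := norm_ne_zero_iff.2 hζ
    rw [eq_div_iff (by positivity), ← h1, mul_comm]
  · refine lintegral_congr fun w => ?_
    congr 1
    apply flat_injective
    funext c
    rw [flat_unflat, flat_act, flat_slice, joinCoord]
    split_ifs with h
    · rw [h, hτi, mul_one]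
    · rfl

end Volume

/-! ### Integration of invariant functions along the orbits -/

section Homogeneity

variable {m : ℕ} {a r : Fin (m + 1) → ℕ} {p : ℝ}

/-- The measure |ζ|^{-2} dζ is scale invariant, so S drops out: with h = |ζ|^q it becomes (2π/q)
dh/h, and a Gamma integral remains. This independence of S lets every orbit carry the same weight.
-/
theorem lintegral_complex_radial {q S : ℝ} (hq : 0 < q) (hS : 0 < S) (n : ℕ) :
    ∫⁻ ζ : ℂ, ENNReal.ofReal ((‖ζ‖ ^ q * S) ^ (n + 1) * Real.exp (-(‖ζ‖ ^ q * S)) / ‖ζ‖ ^ 2) =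
      ENNReal.ofReal (2 * Real.pi / q * n.factorial) := by
  have hm : Measurable fun y : ℝ =>
      ENNReal.ofReal ((y ^ q * S) ^ (n + 1) * Real.exp (-(y ^ q * S)) / y ^ 2) := by fun_prop
  rw [lintegral_polar volume (fun ζ : ℂ =>
    ENNReal.ofReal ((‖ζ‖ ^ q * S) ^ (n + 1) * Real.exp (-(‖ζ‖ ^ q * S)) / ‖ζ‖ ^ 2))
    (hm.comp measurable_norm)]
  have h1 : ∀ y ∈ Set.Ioi (0 : ℝ), ENNReal.ofReal (y ^ (Module.finrank ℝ ℂ - 1)) *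
      ∫⁻ u : Metric.sphere (0 : ℂ) 1, ENNReal.ofReal ((‖y • (u : ℂ)‖ ^ q * S) ^ (n + 1) *
        Real.exp (-(‖y • (u : ℂ)‖ ^ q * S)) / ‖y • (u : ℂ)‖ ^ 2)
          ∂(volume : Measure ℂ).toSphere =
      ENNReal.ofReal (y * ((y ^ q * S) ^ (n + 1) * Real.exp (-(y ^ q * S)) / y ^ 2)) *
        ENNReal.ofReal (2 * Real.pi) := by
    intro y hy
    have hy' : (0 : ℝ) < y := hy
    have h2 : ∀ u : Metric.sphere (0 : ℂ) 1, ‖y • (u : ℂ)‖ = y := fun u => by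
      rw [norm_smul, norm_eq_of_mem_sphere u, mul_one, Real.norm_of_nonneg hy'.le]
    simp only [h2]
    rw [lintegral_const, Measure.toSphere_apply_univ, Complex.volume_ball, ENNReal.ofReal_mul hy'.le,
      Complex.finrank_real_complex]
    simp only [Nat.add_one_sub_one, pow_one, ENNReal.ofReal_one, one_pow, one_mul]
    rw [ENNReal.ofReal_mul (by norm_num), ← NNReal.coe_real_pi, ENNReal.ofReal_coe_nnreal]
    norm_num
    ring
  rw [setLIntegral_congr_fun measurableSet_Ioi h1, lintegral_mul_const _ (by fun_prop),
    lintegral_Ioi_comp_rpow (one_div_pos.2 hq)]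
  have h3 : ∀ h ∈ Set.Ioi (0 : ℝ), ENNReal.ofReal (1 / q * h ^ (1 / q - 1)) *
      ENNReal.ofReal (h ^ (1 / q) * (((h ^ (1 / q)) ^ q * S) ^ (n + 1) *
        Real.exp (-((h ^ (1 / q)) ^ q * S)) / (h ^ (1 / q)) ^ 2)) =
      ENNReal.ofReal (1 / q * S ^ (n + 1)) * ENNReal.ofReal (h ^ n * Real.exp (-(S * h))) := by
    intro h hh
    have hh' : (0 : ℝ) < h := hh
    rw [← ENNReal.ofReal_mul (by positivity), ← ENNReal.ofReal_mul (by positivity)]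
    congr 1
    rw [← Real.rpow_mul hh'.le, one_div_mul_cancel hq.ne', Real.rpow_one,
      Real.rpow_sub_one hh'.ne', mul_comm h S]
    have : (0 : ℝ) < h ^ (1 / q) := by positivity
    field_simp
    ring
  rw [setLIntegral_congr_fun measurableSet_Ioi h3, lintegral_const_mul _ (by fun_prop),
    lintegral_Ioi_pow_mul_exp n hS, ← ENNReal.ofReal_mul (by positivity),
    ← ENNReal.ofReal_mul (by positivity)]
  congr 1
  field_simp

/-- The `-2 Σ a_s r_s`-homogeneous density `∏ (|z_s|^{2p/a_s} / (S(z) |z_s|²))^{r_s}`. -/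
def homDensity (a r : Fin (m + 1) → ℕ) (p : ℝ) (z : Cone r) : ℝ :=
  ∏ s, (‖z s‖ ^ (2 * p / (a s : ℝ)) / (radialSum a r p z * ‖z s‖ ^ 2)) ^ r s

theorem radialSum_nonneg (z : Cone r) : 0 ≤ radialSum a r p z :=
  Finset.sum_nonneg fun _ _ => Real.rpow_nonneg (norm_nonneg _) _

theorem homDensity_nonneg (z : Cone r) : 0 ≤ homDensity a r p z :=
  Finset.prod_nonneg fun s _ => pow_nonneg (div_nonneg (Real.rpow_nonneg (norm_nonneg _) _)
    (mul_nonneg (radialSum_nonneg z) (by positivity))) _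

theorem measurable_radialSum : Measurable (radialSum a r p) := by
  unfold radialSum; fun_prop

theorem measurable_homDensity : Measurable (homDensity a r p) := by
  have := measurable_radialSum (a := a) (r := r) (p := p)
  unfold homDensity; fun_prop

theorem norm_act_rpow (ha : ∀ s, 0 < a s) (t : ℂ) (z : Cone r) (s : Fin (m + 1)) :
    ‖act a r t z s‖ ^ (2 * p / (a s : ℝ)) = ‖t‖ ^ (2 * p) * ‖z s‖ ^ (2 * p / (a s : ℝ)) := by
  have h3 : (a s : ℝ) ≠ 0 := by exact_mod_cast (ha s).ne'
  rw [act, norm_smul, norm_pow, Real.mul_rpow (by positivity) (norm_nonneg _),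
    ← Real.rpow_natCast, ← Real.rpow_mul (norm_nonneg _)]
  congr 2
  field_simp

theorem radialSum_act (ha : ∀ s, 0 < a s) (t : ℂ) (z : Cone r) :
    radialSum a r p (act a r t z) = ‖t‖ ^ (2 * p) * radialSum a r p z := by
  simp only [radialSum, norm_act_rpow ha, Finset.mul_sum]

/-- The factor compensates the Jacobian of z ↦ t · z, so that Q dz is invariant under the action. -/
theorem homDensity_act (ha : ∀ s, 0 < a s) {t : ℂ} (ht : t ≠ 0) (z : Cone r) :
    homDensity a r p (act a r t z) = homDensity a r p z / ‖t‖ ^ (2 * ∑ s, r s * a s) := by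
  have ht' : 0 < ‖t‖ := norm_pos_iff.2 ht
  have h1 : ‖t‖ ^ (2 * ∑ s, r s * a s) = ∏ s, (‖t‖ ^ (2 * a s)) ^ r s := by
    rw [Finset.mul_sum, ← Finset.prod_pow_eq_pow_sum]
    exact Finset.prod_congr rfl fun s _ => by rw [← pow_mul]; congr 1; ring
  rw [h1, homDensity, homDensity, ← Finset.prod_div_distrib]
  refine Finset.prod_congr rfl fun s _ => ?_
  rw [norm_act_rpow ha, radialSum_act ha, ← div_pow]
  congr 1
  have h2 : ‖act a r t z s‖ = ‖t‖ ^ a s * ‖z s‖ := by rw [act, norm_smul, norm_pow]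
  have h3 : (0 : ℝ) < ‖t‖ ^ (2 * p) := Real.rpow_pos_of_pos ht' _
  rw [h2, mul_pow, ← pow_mul, mul_comm (a s) 2]
  have h5 : ‖t‖ ^ (2 * p) * ‖z s‖ ^ (2 * p / (a s : ℝ)) /
      (‖t‖ ^ (2 * p) * radialSum a r p z * (‖t‖ ^ (2 * a s) * ‖z s‖ ^ 2)) =
      ‖z s‖ ^ (2 * p / (a s : ℝ)) / ((radialSum a r p z * ‖z s‖ ^ 2) * ‖t‖ ^ (2 * a s)) := by
    rw [mul_assoc, mul_div_mul_left _ _ h3.ne']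
    congr 1; ring
  rw [h5, div_mul_eq_div_div]

theorem radialSum_slice_pos (i : Coord r) (w : i.Rest → ℂ) : 0 < radialSum a r p (slice i w) := by
  refine Finset.sum_pos' (fun s _ => Real.rpow_nonneg (norm_nonneg _) _) ⟨i.1, Finset.mem_univ _, ?_⟩
  refine Real.rpow_pos_of_pos (norm_pos_iff.2 fun h => ?_) _
  have := slice_self i w
  rw [h] at this
  simp at this

/-- The integral of an invariant function over the chart, as an integral over `ℂ^{|r|}`. -/
theorem lintegral_cone_eq_slice (ha : ∀ s, 0 < a s) (hp : 0 < p) (i : Coord r)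
    (F : Cone r → ENNReal) (hF : Measurable F) (hinv : ∀ t ≠ 0, ∀ z, F (act a r t z) = F z)
    (n : ℕ) :
    ∫⁻ z, F z * ENNReal.ofReal (homDensity a r p z * (radialSum a r p z ^ (n + 1) *
      Real.exp (-radialSum a r p z))) =
    ENNReal.ofReal (Real.pi * a i.1 / p * n.factorial) *
      ∫⁻ w, F (slice i w) * ENNReal.ofReal (homDensity a r p (slice i w)) := by
  have hQm := measurable_homDensity (a := a) (r := r) (p := p)
  have hSm := measurable_radialSum (a := a) (r := r) (p := p)
  have hsm := (continuous_slice i).measurable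
  have hai : (0 : ℝ) < a i.1 := by exact_mod_cast ha i.1
  rw [lintegral_cone_slice ha i _ (by fun_prop)]
  set q : ℝ := 2 * p / a i.1 with hq
  have hq0 : 0 < q := by positivity
  have step : ∀ ζ : ℂ, ζ ≠ 0 → ∀ w,
      ENNReal.ofReal (‖ζ ^ (1 / (a i.1 : ℂ))‖ ^ (2 * ∑ s, r s * a s) / ‖ζ‖ ^ 2) *
      (F (act a r (ζ ^ (1 / (a i.1 : ℂ))) (slice i w)) * ENNReal.ofReal
        (homDensity a r p (act a r (ζ ^ (1 / (a i.1 : ℂ))) (slice i w)) *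
        (radialSum a r p (act a r (ζ ^ (1 / (a i.1 : ℂ))) (slice i w)) ^ (n + 1) *
          Real.exp (-radialSum a r p (act a r (ζ ^ (1 / (a i.1 : ℂ))) (slice i w)))))) =
      (F (slice i w) * ENNReal.ofReal (homDensity a r p (slice i w))) *
        ENNReal.ofReal ((‖ζ‖ ^ q * radialSum a r p (slice i w)) ^ (n + 1) *
          Real.exp (-(‖ζ‖ ^ q * radialSum a r p (slice i w))) / ‖ζ‖ ^ 2) := by
    intro ζ hζ w
    set τ := ζ ^ (1 / (a i.1 : ℂ)) with hτ
    have hτi : τ ^ a i.1 = ζ := by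
      rw [hτ, one_div]
      exact Complex.cpow_nat_inv_pow ζ (ha i.1).ne'
    have hτ0 : τ ≠ 0 := by
      intro h
      rw [h, zero_pow (ha i.1).ne'] at hτi
      exact hζ hτi.symm
    have hnorm : ‖τ‖ ^ (2 * p) = ‖ζ‖ ^ q := by
      rw [← hτi, norm_pow, ← Real.rpow_natCast, ← Real.rpow_mul (norm_nonneg _), hq]
      congr 1
      field_simp
    have h1 : 0 < ‖τ‖ := norm_pos_iff.2 hτ0
    rw [hinv τ hτ0, homDensity_act ha hτ0, radialSum_act ha, hnorm]
    have h2 := homDensity_nonneg (a := a) (p := p) (slice i w)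
    rw [mul_left_comm, mul_assoc, ← ENNReal.ofReal_mul (by positivity), ← ENNReal.ofReal_mul h2]
    congr 2
    field_simp
  have h1 : ∫⁻ ζ : ℂ, ENNReal.ofReal (‖ζ ^ (1 / (a i.1 : ℂ))‖ ^ (2 * ∑ s, r s * a s) / ‖ζ‖ ^ 2) *
      ∫⁻ w, (F (act a r (ζ ^ (1 / (a i.1 : ℂ))) (slice i w)) * ENNReal.ofReal
        (homDensity a r p (act a r (ζ ^ (1 / (a i.1 : ℂ))) (slice i w)) *
        (radialSum a r p (act a r (ζ ^ (1 / (a i.1 : ℂ))) (slice i w)) ^ (n + 1) *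
          Real.exp (-radialSum a r p (act a r (ζ ^ (1 / (a i.1 : ℂ))) (slice i w)))))) =
      ∫⁻ ζ : ℂ, ∫⁻ w, (F (slice i w) * ENNReal.ofReal (homDensity a r p (slice i w))) *
        ENNReal.ofReal ((‖ζ‖ ^ q * radialSum a r p (slice i w)) ^ (n + 1) *
          Real.exp (-(‖ζ‖ ^ q * radialSum a r p (slice i w))) / ‖ζ‖ ^ 2) := by
    refine lintegral_congr_ae ?_
    filter_upwards [Measure.ae_ne volume (0 : ℂ)] with ζ hζ
    have := measurable_act (a := a) (r := r) (ζ ^ (1 / (a i.1 : ℂ)))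
    rw [← lintegral_const_mul _ (by fun_prop)]
    exact lintegral_congr (step ζ hζ)
  -- After the swap, the inner integral over ζ is the constant of `lintegral_complex_radial`, the
  -- same for all w; with q = 2p/a_i it equals (π a_i/p) n!.
  rw [h1, lintegral_lintegral_swap (by fun_prop), ← lintegral_const_mul _ (by fun_prop)]
  refine lintegral_congr fun w => ?_
  rw [lintegral_const_mul _ (by fun_prop), lintegral_complex_radial hq0 (radialSum_slice_pos i w) n,
    mul_comm]
  congr 3
  rw [hq]
  field_simp

end Homogeneity

/-! ### Polar coordinates in every factor and reduction to the simplex -/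

section Spheres

theorem toSphere_univ {n : ℕ} (hn : 0 < n) :
    (volume : Measure (EuclideanSpace ℂ (Fin n))).toSphere Set.univ =
      ENNReal.ofReal (2 * Real.pi ^ n / (n - 1).factorial) := by
  have : Nonempty (Fin n) := ⟨⟨0, hn⟩⟩
  have : Nontrivial (EuclideanSpace ℂ (Fin n)) :=
    (WithLp.toLp_injective 2 (V := Fin n → ℂ)).nontrivial
  rw [Measure.toSphere_apply_univ,
    InnerProductSpace.volume_ball_of_dim_even (finrank_euclidean_complex n),
    finrank_euclidean_complex, ENNReal.ofReal_one, one_pow, one_mul, ← ENNReal.ofReal_natCast,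
    ← ENNReal.ofReal_mul (by positivity)]
  congr 1
  obtain ⟨k, rfl⟩ : ∃ k, n = k + 1 := ⟨n - 1, by omega⟩
  rw [Nat.factorial_succ, Nat.add_sub_cancel]
  push_cast
  field_simp

theorem sphere_area_pos {n : ℕ} : 0 < 2 * Real.pi ^ n / (n - 1).factorial := by
  have := Real.pi_pos
  positivity

theorem toSphere_eq_smul {n : ℕ} (hn : 0 < n) :
    (volume : Measure (EuclideanSpace ℂ (Fin n))).toSphere =
      ENNReal.ofReal (2 * Real.pi ^ n / (n - 1).factorial) • sphereMeasure n := by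
  have h0 : ENNReal.ofReal (2 * Real.pi ^ n / (n - 1).factorial) ≠ 0 := by
    rw [Ne, ENNReal.ofReal_eq_zero, not_le]; exact sphere_area_pos
  rw [sphereMeasure, toSphere_univ hn, smul_smul, ENNReal.mul_inv_cancel h0 ENNReal.ofReal_ne_top,
    one_smul]

theorem isProbabilityMeasure_sphereMeasure {n : ℕ} (hn : 0 < n) :
    IsProbabilityMeasure (sphereMeasure n) := by
  have h0 : ENNReal.ofReal (2 * Real.pi ^ n / (n - 1).factorial) ≠ 0 := by
    rw [Ne, ENNReal.ofReal_eq_zero, not_le]; exact sphere_area_pos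
  refine ⟨?_⟩
  rw [sphereMeasure, Measure.smul_apply, toSphere_univ hn, smul_eq_mul,
    ENNReal.inv_mul_cancel h0 ENNReal.ofReal_ne_top]

/-- The radial density of the volume of `ℂ^n` in the variable `h = |z|^{1/α}`. -/
def radialDensity (n : ℕ) (α : ℝ) (h : ℝ) : ℝ :=
  2 * Real.pi ^ n / (n - 1).factorial * (α * h ^ (α - 1) * (h ^ α) ^ (2 * n - 1))

theorem measurable_radialDensity (n : ℕ) (α : ℝ) : Measurable (radialDensity n α) := by
  unfold radialDensity; fun_prop

/-- Polar coordinates followed by the substitution |z| = h^α. It will be used with α = a_s/2p, for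
which h = |z_s|^{2p/a_s}. -/
theorem map_polar_rpow {n : ℕ} (hn : 0 < n) {α : ℝ} (hα : 0 < α) :
    Measure.map (fun x : ℝ × Sph n => (x.1 ^ α) • (x.2 : EuclideanSpace ℂ (Fin n)))
      ((((volume : Measure ℝ).restrict (Set.Ioi 0)).withDensity
        fun h => ENNReal.ofReal (radialDensity n α h)).prod (sphereMeasure n)) = volume := by
  have := isProbabilityMeasure_sphereMeasure hn
  have : Nonempty (Fin n) := ⟨⟨0, hn⟩⟩
  have : Nontrivial (EuclideanSpace ℂ (Fin n)) :=
    (WithLp.toLp_injective 2 (V := Fin n → ℂ)).nontrivial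
  have hm : Measurable (fun x : ℝ × Sph n => (x.1 ^ α) • (x.2 : EuclideanSpace ℂ (Fin n))) := by
    fun_prop
  have hd := measurable_radialDensity n α
  refine Measure.ext_of_lintegral _ fun K hK => ?_
  have hKm : Measurable fun x : ℝ × Sph n => K (x.1 ^ α • (x.2 : EuclideanSpace ℂ (Fin n))) :=
    hK.comp hm
  have hpol := lintegral_polar (volume : Measure (EuclideanSpace ℂ (Fin n))) K hK
  rw [lintegral_Ioi_comp_rpow hα] at hpol
  rw [lintegral_map hK hm, lintegral_prod _ hKm.aemeasurable,
    lintegral_withDensity_eq_lintegral_mul _ (by fun_prop) hKm.lintegral_prod_right', hpol]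
  refine setLIntegral_congr_fun measurableSet_Ioi fun h hh => ?_
  have hh' : (0 : ℝ) < h := hh
  have hp := (sphere_area_pos (n := n)).le
  simp only [Pi.mul_apply]
  rw [toSphere_eq_smul hn, lintegral_smul_measure, finrank_euclidean_complex, smul_eq_mul,
    ← mul_assoc, ← mul_assoc, ← ENNReal.ofReal_mul (by positivity),
    ← ENNReal.ofReal_mul (by positivity)]
  congr 2
  rw [radialDensity]
  ring

variable {m : ℕ} {a r : Fin (m + 1) → ℕ} {p : ℝ}

theorem measurable_scaledPoint : Measurable
    fun x : (Fin (m + 1) → ℝ) × ((s : Fin (m + 1)) → Sph (r s)) => scaledPoint a r p x.1 x.2 := by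
  unfold scaledPoint
  fun_prop

theorem isProbabilityMeasure_spheresMeasure (hr : ∀ s, 0 < r s) :
    IsProbabilityMeasure (spheresMeasure r) := by
  have := fun s => isProbabilityMeasure_sphereMeasure (hr s)
  unfold spheresMeasure
  infer_instance

theorem sigmaFinite_spheresMeasure (hr : ∀ s, 0 < r s) : SigmaFinite (spheresMeasure r) := by
  have := isProbabilityMeasure_spheresMeasure hr
  have : IsFiniteMeasure (spheresMeasure r) := inferInstance
  infer_instance

theorem sFinite_spheresMeasure (hr : ∀ s, 0 < r s) : SFinite (spheresMeasure r) := by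
  have := sigmaFinite_spheresMeasure hr
  infer_instance

/-- Polar coordinates in all the factors of `ℂ^{r_1} × ⋯ × ℂ^{r_k}`. -/
theorem lintegral_cone_polar (ha : ∀ s, 0 < a s) (hr : ∀ s, 0 < r s) (hp : 0 < p)
    (K : Cone r → ENNReal) (hK : Measurable K) :
    ∫⁻ z, K z = ∫⁻ h, (∏ s, ENNReal.ofReal (radialDensity (r s) (a s / (2 * p)) (h s))) *
      ∫⁻ u, K (scaledPoint a r p h u) ∂spheresMeasure r
        ∂(Measure.pi fun _ : Fin (m + 1) => (volume : Measure ℝ).restrict (Set.Ioi 0)) := by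
  have hprob := fun s => isProbabilityMeasure_sphereMeasure (hr s)
  have := isProbabilityMeasure_spheresMeasure hr
  have hα : ∀ s, 0 < (a s : ℝ) / (2 * p) := fun s => by
    have : (0 : ℝ) < a s := by exact_mod_cast ha s
    positivity
  have hsf : ∀ s, SigmaFinite (((volume : Measure ℝ).restrict (Set.Ioi 0)).withDensity
      fun h => ENNReal.ofReal (radialDensity (r s) (a s / (2 * p)) h)) := fun s =>
    SigmaFinite.withDensity_ofReal _
  set Λ : Fin (m + 1) → Measure ℝ := fun s => ((volume : Measure ℝ).restrict (Set.Ioi 0)).withDensity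
      fun h => ENNReal.ofReal (radialDensity (r s) (a s / (2 * p)) h) with hΛ
  have hmap := fun s => map_polar_rpow (hr s) (hα s)
  have hmeas : ∀ s, Measurable (fun x : ℝ × Sph (r s) =>
      (x.1 ^ ((a s : ℝ) / (2 * p))) • (x.2 : EuclideanSpace ℂ (Fin (r s)))) := fun s => by fun_prop
  -- The polar description of each factor is multiplied over s; the radii and the unit vectors are
  -- regrouped afterwards by `pi_prod_eq_map`.
  have hvol : (volume : Measure (Cone r)) = Measure.map
      (fun x : (s : Fin (m + 1)) → ℝ × Sph (r s) => fun s =>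
        ((x s).1 ^ ((a s : ℝ) / (2 * p))) • ((x s).2 : EuclideanSpace ℂ (Fin (r s))))
      (Measure.pi fun s => (Λ s).prod (sphereMeasure (r s))) := by
    have hsf' : ∀ s, SigmaFinite (Measure.map (fun x : ℝ × Sph (r s) =>
      (x.1 ^ ((a s : ℝ) / (2 * p))) • (x.2 : EuclideanSpace ℂ (Fin (r s))))
        ((Λ s).prod (sphereMeasure (r s)))) := fun s => by
      rw [hΛ, hmap s]; infer_instance
    rw [Measure.pi_map_pi (μ := fun s => (Λ s).prod (sphereMeasure (r s)))
      (fun s => (hmeas s).aemeasurable), volume_pi]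
    congr 1
    funext s
    exact (hmap s).symm
  rw [← pi_prod_eq_map, Measure.map_map (by fun_prop) (by fun_prop)] at hvol
  have hcomp : ((fun x : (s : Fin (m + 1)) → ℝ × Sph (r s) => fun s =>
        ((x s).1 ^ ((a s : ℝ) / (2 * p))) • ((x s).2 : EuclideanSpace ℂ (Fin (r s)))) ∘
        fun (x : (Fin (m + 1) → ℝ) × ((s : Fin (m + 1)) → Sph (r s))) i => (x.1 i, x.2 i)) =
      fun x => scaledPoint a r p x.1 x.2 := rfl
  have hKm : Measurable fun x : (Fin (m + 1) → ℝ) × ((s : Fin (m + 1)) → Sph (r s)) =>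
    K (scaledPoint a r p x.1 x.2) := hK.comp measurable_scaledPoint
  rw [hcomp] at hvol
  rw [hvol, lintegral_map hK measurable_scaledPoint, lintegral_prod _ hKm.aemeasurable, hΛ,
    pi_withDensity _ fun s => (measurable_radialDensity _ _).ennreal_ofReal]
  have hd : Measurable fun h : Fin (m + 1) → ℝ =>
      ∏ s, ENNReal.ofReal (radialDensity (r s) (a s / (2 * p)) (h s)) :=
    Finset.measurable_prod _ fun s _ =>
      (measurable_radialDensity _ _).ennreal_ofReal.comp (measurable_pi_apply s)
  exact lintegral_withDensity_eq_lintegral_mul _ hd hKm.lintegral_prod_right'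

theorem norm_scaledPoint {h : Fin (m + 1) → ℝ} (hh : ∀ s, 0 ≤ h s)
    (u : (s : Fin (m + 1)) → Sph (r s)) (s : Fin (m + 1)) :
    ‖scaledPoint a r p h u s‖ = h s ^ ((a s : ℝ) / (2 * p)) := by
  rw [scaledPoint, norm_smul, norm_eq_of_mem_sphere, mul_one,
    Real.norm_of_nonneg (Real.rpow_nonneg (hh s) _)]

theorem radialSum_scaledPoint (ha : ∀ s, 0 < a s) (hp : 0 < p) {h : Fin (m + 1) → ℝ}
    (hh : ∀ s, 0 ≤ h s) (u : (s : Fin (m + 1)) → Sph (r s)) (s : Fin (m + 1)) :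
    ‖scaledPoint a r p h u s‖ ^ (2 * p / (a s : ℝ)) = h s := by
  have : (0 : ℝ) < a s := by exact_mod_cast ha s
  rw [norm_scaledPoint hh, ← Real.rpow_mul (hh s), div_mul_div_cancel₀ (by positivity),
    div_self (by positivity), Real.rpow_one]

/-- In the variables h the weighted action of positive reals is ordinary scaling, so invariant
functions of z become functions on the simplex and the spheres. -/
theorem scaledPoint_smul {S : ℝ} (hS : 0 < S) {x : Fin (m + 1) → ℝ}
    (hx : ∀ s, 0 ≤ x s) (u : (s : Fin (m + 1)) → Sph (r s)) :
    scaledPoint a r p (S • x) u =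
      act a r ((S ^ (1 / (2 * p)) : ℝ) : ℂ) (scaledPoint a r p x u) := by
  funext s
  simp only [scaledPoint, act, Pi.smul_apply, smul_eq_mul]
  rw [Real.mul_rpow hS.le (hx s), ← Complex.ofReal_pow, ← Real.rpow_natCast,
    ← Real.rpow_mul hS.le, mul_smul]
  have : 1 / (2 * p) * (a s : ℝ) = a s / (2 * p) := by ring
  rw [this]
  ext j
  simp

/-- The constant `∏ π^{r_s} a_s / (p (r_s - 1)!)`. -/
def polarConst (a r : Fin (m + 1) → ℕ) (p : ℝ) : ℝ :=
  ∏ s, (Real.pi ^ r s * a s / (p * (r s - 1).factorial))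

theorem polarConst_pos (ha : ∀ s, 0 < a s) (hp : 0 < p) : 0 < polarConst a r p :=
  Finset.prod_pos fun s _ => by
    have : (0 : ℝ) < a s := by exact_mod_cast ha s
    have := Real.pi_pos
    positivity

/-- The density `∏ h_s^{r_s - 1}`. -/
def dirichletDensity (r : Fin (m + 1) → ℕ) (h : Fin (m + 1) → ℝ) : ℝ := ∏ s, h s ^ (r s - 1)

theorem measurable_dirichletDensity : Measurable (dirichletDensity r) := by
  unfold dirichletDensity; fun_prop

/-- In the variables h one has S = ∑ h_s. The factors |z_s|^{-2 r_s} in Q cancel the Euclidean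
radial density up to h_s^{-1}, and S^N cancels the denominators of Q. What remains is ∏ h_s^{r_s-1}
e^{-∑ h_s}. -/
theorem lintegral_cone_gamma (ha : ∀ s, 0 < a s) (hr : ∀ s, 0 < r s) (hp : 0 < p)
    (F : Cone r → ENNReal) (hF : Measurable F) :
    ∫⁻ z, F z * ENNReal.ofReal (homDensity a r p z * (radialSum a r p z ^ (∑ s, r s) *
      Real.exp (-radialSum a r p z))) =
    ENNReal.ofReal (polarConst a r p) *
      ∫⁻ h, ENNReal.ofReal (dirichletDensity r h * Real.exp (-∑ s, h s)) *
        ∫⁻ u, F (scaledPoint a r p h u) ∂spheresMeasure r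
        ∂(Measure.pi fun _ : Fin (m + 1) => (volume : Measure ℝ).restrict (Set.Ioi 0)) := by
  have := sFinite_spheresMeasure hr
  have hQm := measurable_homDensity (a := a) (r := r) (p := p)
  have hSm := measurable_radialSum (a := a) (r := r) (p := p)
  have hdm := measurable_dirichletDensity (r := r)
  have hKm : Measurable fun x : (Fin (m + 1) → ℝ) × ((s : Fin (m + 1)) → Sph (r s)) =>
    F (scaledPoint a r p x.1 x.2) := hF.comp measurable_scaledPoint
  have hKm' := hKm.lintegral_prod_right' (ν := spheresMeasure r)
  rw [lintegral_cone_polar ha hr hp _ (by fun_prop), ← lintegral_const_mul _ (by fun_prop)]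
  have hpos : ∀ᵐ h ∂(Measure.pi fun _ : Fin (m + 1) => (volume : Measure ℝ).restrict (Set.Ioi 0)),
      ∀ s, 0 < h s := by
    rw [← Measure.restrict_pi_pi]
    filter_upwards [ae_restrict_mem (MeasurableSet.univ_pi fun _ => measurableSet_Ioi)] with h hh s
    exact hh s trivial
  refine lintegral_congr_ae ?_
  filter_upwards [hpos] with h hh
  have hh0 : ∀ s, 0 ≤ h s := fun s => (hh s).le
  have hsum : 0 < ∑ s, h s := Finset.sum_pos (fun s _ => hh s) Finset.univ_nonempty
  have hS : ∀ u, radialSum a r p (scaledPoint a r p h u) = ∑ s, h s := fun u =>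
    Finset.sum_congr rfl fun s _ => radialSum_scaledPoint ha hp hh0 u s
  have hQ : ∀ u, homDensity a r p (scaledPoint a r p h u) =
      ∏ s, (h s / ((∑ s, h s) * (h s ^ ((a s : ℝ) / (2 * p))) ^ 2)) ^ r s := by
    intro u
    rw [homDensity, hS]
    refine Finset.prod_congr rfl fun s _ => ?_
    rw [radialSum_scaledPoint ha hp hh0, norm_scaledPoint hh0]
  simp only [hS, hQ]
  have hKu : Measurable fun u : (s : Fin (m + 1)) → Sph (r s) => F (scaledPoint a r p h u) :=
    hKm.comp measurable_prodMk_left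
  rw [lintegral_mul_const _ hKu, mul_comm (∫⁻ u, F (scaledPoint a r p h u) ∂spheresMeasure r)]
  generalize ∫⁻ u, F (scaledPoint a r p h u) ∂spheresMeasure r = I
  rw [← mul_assoc, ← mul_assoc (ENNReal.ofReal (polarConst a r p))]
  congr 1
  have hα : ∀ s, 0 < (a s : ℝ) / (2 * p) := fun s => by
    have : (0 : ℝ) < a s := by exact_mod_cast ha s
    positivity
  have hrd : ∀ s, 0 ≤ radialDensity (r s) (a s / (2 * p)) (h s) := fun s => by
    have := hh s
    have := hα s
    have := sphere_area_pos (n := r s)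
    unfold radialDensity
    positivity
  rw [← ENNReal.ofReal_prod_of_nonneg fun s _ => hrd s, ← ENNReal.ofReal_mul (by
    exact Finset.prod_nonneg fun s _ => hrd s), ← ENNReal.ofReal_mul (polarConst_pos ha hp).le]
  congr 1
  have hsplit : (∑ s, h s) ^ (∑ s, r s) = ∏ s, (∑ t, h t) ^ r s := by
    rw [Finset.prod_pow_eq_pow_sum]
  rw [hsplit, ← mul_assoc, ← mul_assoc, ← mul_assoc, ← Finset.prod_mul_distrib,
    ← Finset.prod_mul_distrib, polarConst, dirichletDensity, ← Finset.prod_mul_distrib]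
  congr 1
  refine Finset.prod_congr rfl fun s _ => ?_
  have h1 := hh s
  rw [radialDensity, Real.rpow_sub_one h1.ne', div_pow, mul_pow]
  obtain ⟨k, hk⟩ : ∃ k, r s = k + 1 := ⟨r s - 1, by have := hr s; omega⟩
  rw [hk, Nat.add_sub_cancel, show 2 * (k + 1) - 1 = 2 * k + 1 by omega]
  have h2 : 0 < h s ^ ((a s : ℝ) / (2 * p)) := Real.rpow_pos_of_pos h1 _
  field_simp
  ring

/-- With h = S x the density contributes S^{∑ (r_s - 1)} and the cone coordinates S^m, in total
S^{N-1}; integrating against e^{-S} gives (N-1)!. -/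
theorem lintegral_gamma_simplex (hr : ∀ s, 0 < r s) (Φ : (Fin (m + 1) → ℝ) → ENNReal)
    (hΦ : Measurable Φ)
    (hinv : ∀ S : ℝ, 0 < S → ∀ x : Fin (m + 1) → ℝ, (∀ s, 0 ≤ x s) → Φ (S • x) = Φ x) :
    ∫⁻ h, ENNReal.ofReal (dirichletDensity r h * Real.exp (-∑ s, h s)) * Φ h
        ∂(Measure.pi fun _ : Fin (m + 1) => (volume : Measure ℝ).restrict (Set.Ioi 0)) =
      ENNReal.ofReal ((∑ s, r s) - 1).factorial *
        ∫⁻ x, ENNReal.ofReal (dirichletDensity r x) * Φ x ∂simplexMeasure m := by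
  have hdm := measurable_dirichletDensity (r := r)
  rw [lintegral_cone_coordinates _ (by fun_prop)]
  -- There are m + 1 blocks, each of positive size, so the subtractions of 1 are genuine.
  have hdeg : ∑ s, (r s - 1) + m = (∑ s, r s) - 1 := by
    have : ∑ s, r s = ∑ s, (r s - 1) + (m + 1) := by
      have h1 : ∑ s, r s = ∑ s, ((r s - 1) + 1) :=
        Finset.sum_congr rfl fun s _ => by have := hr s; omega
      rw [h1, Finset.sum_add_distrib]; simp
    omega
  have hae : ∀ᵐ x ∂simplexMeasure m, (∀ s, 0 ≤ x s) ∧ ∑ s, x s = 1 := by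
    rw [simplexMeasure]
    have hms : MeasurableSet (stdSimplex ℝ (Fin (m + 1))) := (isClosed_stdSimplex ℝ (Fin (m + 1))).measurableSet
    have hset : MeasurableSet {x : Fin (m + 1) → ℝ | (∀ s, 0 ≤ x s) ∧ ∑ s, x s = 1} := hms
    rw [ae_map_iff (measurable_simplexPoint m).aemeasurable hset]
    exact ae_restrict_mem ((measurable_simplexPoint m) hms)
  have key : ∀ S ∈ Set.Ioi (0 : ℝ), ENNReal.ofReal (S ^ m) * ∫⁻ x, ENNReal.ofReal
      (dirichletDensity r (S • x) * Real.exp (-∑ s, (S • x) s)) * Φ (S • x) ∂simplexMeasure m =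
      ENNReal.ofReal (S ^ ((∑ s, r s) - 1) * Real.exp (-(1 * S))) *
        ∫⁻ x, ENNReal.ofReal (dirichletDensity r x) * Φ x ∂simplexMeasure m := by
    intro S hS
    have hS' : (0 : ℝ) < S := hS
    rw [← lintegral_const_mul _ (by fun_prop), ← lintegral_const_mul _ (by fun_prop)]
    refine lintegral_congr_ae ?_
    filter_upwards [hae] with x hx
    rw [hinv S hS' x hx.1, ← mul_assoc, ← mul_assoc, ← ENNReal.ofReal_mul (by positivity),
      ← ENNReal.ofReal_mul (by positivity)]
    congr 2
    have h1 : ∑ s, (S • x) s = S := by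
      simp only [Pi.smul_apply, smul_eq_mul, ← Finset.mul_sum, hx.2, mul_one]
    have h2 : dirichletDensity r (S • x) = S ^ (∑ s, (r s - 1)) * dirichletDensity r x := by
      simp only [dirichletDensity, Pi.smul_apply, smul_eq_mul, mul_pow, Finset.prod_mul_distrib,
        Finset.prod_pow_eq_pow_sum]
    rw [h1, h2, ← hdeg, pow_add, one_mul]
    ring
  rw [setLIntegral_congr_fun measurableSet_Ioi key, lintegral_mul_const _ (by fun_prop),
    lintegral_Ioi_pow_mul_exp _ one_pos, one_pow, div_one]

theorem lintegral_gamma_univ (r : Fin (m + 1) → ℕ) :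
    ∫⁻ h, ENNReal.ofReal (dirichletDensity r h * Real.exp (-∑ s, h s))
        ∂(Measure.pi fun _ : Fin (m + 1) => (volume : Measure ℝ).restrict (Set.Ioi 0)) =
      ENNReal.ofReal (∏ s, ((r s - 1).factorial : ℝ)) := by
  have hpos : ∀ᵐ h ∂(Measure.pi fun _ : Fin (m + 1) => (volume : Measure ℝ).restrict (Set.Ioi 0)),
      ∀ s, 0 < h s := by
    rw [← Measure.restrict_pi_pi]
    filter_upwards [ae_restrict_mem (MeasurableSet.univ_pi fun _ => measurableSet_Ioi)] with h hh s
    exact hh s trivial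
  have h1 : ∫⁻ h, ENNReal.ofReal (dirichletDensity r h * Real.exp (-∑ s, h s))
        ∂(Measure.pi fun _ : Fin (m + 1) => (volume : Measure ℝ).restrict (Set.Ioi 0)) =
      ∫⁻ h, ∏ s, ENNReal.ofReal (h s ^ (r s - 1) * Real.exp (-(1 * h s)))
        ∂(Measure.pi fun _ : Fin (m + 1) => (volume : Measure ℝ).restrict (Set.Ioi 0)) := by
    refine lintegral_congr_ae ?_
    filter_upwards [hpos] with h hh
    rw [← ENNReal.ofReal_prod_of_nonneg fun s _ => by have := hh s; positivity]
    congr 1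
    rw [Finset.prod_mul_distrib, ← Real.exp_sum, dirichletDensity]
    simp
  rw [h1, lintegral_fin_prod_eq_prod
    (fun s y => ENNReal.ofReal (y ^ (r s - 1) * Real.exp (-(1 * y)))) fun s => by fun_prop]
  rw [ENNReal.ofReal_prod_of_nonneg fun s _ => by positivity]
  refine Finset.prod_congr rfl fun s _ => ?_
  rw [lintegral_Ioi_pow_mul_exp _ one_pos, one_pow, div_one]

end Spheres

/-! ### Equality of the slice integral and the simplex integral -/

section Comparison

/-- Integrability and integrals depend only on the distribution of values, so an identity of
push-forwards transfers both from the finite measure ν to μ. -/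
theorem integral_eq_of_map_eq {X Y : Type*} [MeasurableSpace X] [MeasurableSpace Y]
    {μ : Measure X} {ν : Measure Y} [IsFiniteMeasure ν] {φ : X → ℂ} {ψ : Y → ℂ}
    (hφ : Measurable φ) (hψ : Measurable ψ) {C : ℝ} (hC : ∀ y, ‖ψ y‖ ≤ C) {c : ENNReal}
    (hc : c ≠ ⊤) (h : μ.map φ = c • ν.map ψ) :
    Integrable φ μ ∧ ∫ x, φ x ∂μ = c.toReal • ∫ y, ψ y ∂ν := by
  have hψi : Integrable ψ ν :=
    Integrable.of_bound hψ.aestronglyMeasurable C (Eventually.of_forall hC)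
  have hid : Integrable id (ν.map ψ) :=
    (integrable_map_measure measurable_id.aestronglyMeasurable hψ.aemeasurable).2 hψi
  refine ⟨(integrable_map_measure measurable_id.aestronglyMeasurable hφ.aemeasurable).1
    (h ▸ hid.smul_measure hc), ?_⟩
  have h1 := integral_map (μ := μ) hφ.aemeasurable (f := id) measurable_id.aestronglyMeasurable
  have h2 := integral_map (μ := ν) hψ.aemeasurable (f := id) measurable_id.aestronglyMeasurable
  simp only [id] at h1 h2
  rw [← h1, h, integral_smul_measure, h2]

variable {m : ℕ} {a r : Fin (m + 1) → ℕ} {p : ℝ}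

instance : SFinite (simplexMeasure m) := by
  unfold simplexMeasure; infer_instance

/-- The points of the closed orthant with a zero coordinate form a null set stable under positive
scaling. The cone formula makes its measure (∫ S^m dS) times the simplex measure of the bad set, and
the first factor is nonzero. -/
theorem ae_simplexMeasure_pos (m : ℕ) : ∀ᵐ x ∂simplexMeasure m, ∀ s, 0 < x s := by
  have hms : MeasurableSet {x : Fin (m + 1) → ℝ | ∀ s, 0 < x s} := by
    simp only [Set.ofPred_forall]
    exact MeasurableSet.iInter fun s => measurableSet_lt measurable_const (measurable_pi_apply s)
  set A := {x : Fin (m + 1) → ℝ | ∀ s, 0 < x s} with hA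
  have hpos : ∀ᵐ h ∂(Measure.pi fun _ : Fin (m + 1) => (volume : Measure ℝ).restrict (Set.Ioi 0)),
      h ∈ A := by
    rw [← Measure.restrict_pi_pi]
    filter_upwards [ae_restrict_mem (MeasurableSet.univ_pi fun _ => measurableSet_Ioi)] with h hh s
    exact hh s trivial
  have h1 := lintegral_cone_coordinates (m := m) (Aᶜ.indicator 1)
    (measurable_one.indicator hms.compl)
  rw [lintegral_indicator_one hms.compl, show Measure.pi _ Aᶜ = 0 from hpos] at h1
  have h2 : ∀ S ∈ Set.Ioi (0 : ℝ), ENNReal.ofReal (S ^ m) *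
      ∫⁻ x, Aᶜ.indicator 1 (S • x) ∂simplexMeasure m =
      ENNReal.ofReal (S ^ m) * simplexMeasure m Aᶜ := by
    intro S hS
    have hS' : (0 : ℝ) < S := hS
    rw [← lintegral_indicator_one hms.compl]
    congr 2
    funext x
    have : S • x ∈ Aᶜ ↔ x ∈ Aᶜ := by simp [hA, hS']
    by_cases hx : x ∈ Aᶜ
    · rw [Set.indicator_of_mem hx, Set.indicator_of_mem (this.2 hx)]; rfl
    · rw [Set.indicator_of_notMem hx, Set.indicator_of_notMem (mt this.1 hx)]
  rw [setLIntegral_congr_fun measurableSet_Ioi h2, lintegral_mul_const _ (by fun_prop)] at h1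
  rcases mul_eq_zero.1 h1.symm with h3 | h3
  · exfalso
    rw [lintegral_eq_zero_iff (by fun_prop), EventuallyEq, ae_restrict_iff' measurableSet_Ioi] at h3
    have h4 : ∀ᵐ S : ℝ, S ∉ Set.Ioi (0 : ℝ) := by
      filter_upwards [h3] with S hS hS'
      have h5 := hS hS'
      simp only [Pi.zero_apply, ENNReal.ofReal_eq_zero] at h5
      exact absurd (pow_pos (show (0 : ℝ) < S from hS') m) (not_lt.2 h5)
    have h6 : volume (Set.Ioi (0 : ℝ)) = 0 := by
      rw [← compl_mem_ae_iff]; exact h4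
    simp at h6
  · exact h3

/-- The case Φ = 1 of `lintegral_gamma_simplex`: the integral over the orthant is a product of Gamma
integrals. -/
theorem lintegral_dirichletDensity (hr : ∀ s, 0 < r s) :
    ∫⁻ x, ENNReal.ofReal (dirichletDensity r x) ∂simplexMeasure m =
      ENNReal.ofReal ((∏ s, ((r s - 1).factorial : ℝ)) / ((∑ s, r s) - 1).factorial) := by
  have h := lintegral_gamma_simplex hr (fun _ => 1) measurable_const fun _ _ _ _ => rfl
  simp only [mul_one] at h
  rw [lintegral_gamma_univ] at h
  have h0 : (0 : ℝ) < ((∑ s, r s) - 1).factorial := by positivity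
  rw [ENNReal.ofReal_div_of_pos h0, h, mul_comm,
    ENNReal.mul_div_cancel_right (ENNReal.ofReal_pos.2 h0).ne' ENNReal.ofReal_ne_top]

/-- Comparison of the densities on an affine slice and on the simplex times the spheres. -/
theorem lintegral_slice_eq_simplex (ha : ∀ s, 0 < a s) (hr : ∀ s, 0 < r s) (hp : 0 < p)
    (i : Coord r) (F : Cone r → ENNReal) (hF : Measurable F)
    (hinv : ∀ t : ℂ, t ≠ 0 → ∀ z, F (act a r t z) = F z) :
    ∫⁻ w, F (slice i w) * ENNReal.ofReal (homDensity a r p (slice i w)) =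
      ENNReal.ofReal (p / (Real.pi * a i.1) * polarConst a r p) *
        ∫⁻ x, F (scaledPoint a r p x.1 x.2) * ENNReal.ofReal (dirichletDensity r x.1)
          ∂(simplexMeasure m).prod (spheresMeasure r) := by
  have := sFinite_spheresMeasure hr
  have hai : (0 : ℝ) < a i.1 := by exact_mod_cast ha i.1
  have hpi := Real.pi_pos
  have hdm := measurable_dirichletDensity (r := r)
  have hKm : Measurable fun x : (Fin (m + 1) → ℝ) × ((s : Fin (m + 1)) → Sph (r s)) =>
    F (scaledPoint a r p x.1 x.2) := hF.comp measurable_scaledPoint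
  have hKm' := hKm.lintegral_prod_right' (ν := spheresMeasure r)
  have hN : ∑ s, r s = ((∑ s, r s) - 1) + 1 := by
    have : 0 < ∑ s, r s := Finset.sum_pos (fun s _ => hr s) Finset.univ_nonempty
    omega
  have h1 := lintegral_cone_gamma ha hr hp F hF
  -- The choice n = N - 1 makes the power S^{n+1} match the S^N of `lintegral_cone_gamma`.
  have h2 := lintegral_cone_eq_slice ha hp i F hF hinv ((∑ s, r s) - 1)
  rw [← hN] at h2
  have h3 := lintegral_gamma_simplex hr (fun h => ∫⁻ u, F (scaledPoint a r p h u) ∂spheresMeasure r)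
    hKm' fun S hS x hx => by
      simp only [scaledPoint_smul hS hx]
      refine lintegral_congr fun u => hinv _ ?_ _
      exact_mod_cast (Real.rpow_pos_of_pos hS _).ne'
  rw [h1, h3] at h2
  have h4 : ∫⁻ x, F (scaledPoint a r p x.1 x.2) * ENNReal.ofReal (dirichletDensity r x.1)
          ∂(simplexMeasure m).prod (spheresMeasure r) =
      ∫⁻ x, ENNReal.ofReal (dirichletDensity r x) *
        ∫⁻ u, F (scaledPoint a r p x u) ∂spheresMeasure r ∂simplexMeasure m := by
    have hm : Measurable fun x : (Fin (m + 1) → ℝ) × ((s : Fin (m + 1)) → Sph (r s)) =>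
        F (scaledPoint a r p x.1 x.2) * ENNReal.ofReal (dirichletDensity r x.1) :=
      hKm.mul (hdm.comp measurable_fst).ennreal_ofReal
    rw [lintegral_prod _ hm.aemeasurable]
    refine lintegral_congr fun x => ?_
    have hKx : Measurable fun u : (s : Fin (m + 1)) → Sph (r s) => F (scaledPoint a r p x u) :=
      hKm.comp measurable_prodMk_left
    dsimp only
    rw [lintegral_mul_const _ hKx, mul_comm]
  rw [h4]
  have h5 : p / (Real.pi * a i.1) * polarConst a r p =
      (Real.pi * a i.1 / p * ((∑ s, r s) - 1).factorial)⁻¹ *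
        (polarConst a r p * ((∑ s, r s) - 1).factorial) := by
    have h7 : (0 : ℝ) < ((∑ s, r s) - 1).factorial := by positivity
    generalize (((∑ s, r s) - 1).factorial : ℝ) = n at h7
    field_simp
  have h6 : (0 : ℝ) < Real.pi * a i.1 / p * ((∑ s, r s) - 1).factorial := by positivity
  rw [h5, ENNReal.ofReal_mul (by positivity), ENNReal.ofReal_mul (polarConst_pos ha hp).le,
    ENNReal.ofReal_inv_of_pos h6, mul_assoc, mul_assoc, h2, ← mul_assoc, ENNReal.inv_mul_cancel,
    one_mul]
  · exact (ENNReal.ofReal_pos.2 h6).ne'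
  · exact ENNReal.ofReal_ne_top

/-- The nonnegative identity applied to K ∘ F for all measurable K ≥ 0 says that F has proportional
distributions under the two weighted measures. The simplex side is finite by the Dirichlet integral
and F is bounded, which gives both integrabilities. -/
theorem integral_slice_eq_simplex (ha : ∀ s, 0 < a s) (hr : ∀ s, 0 < r s) (hp : 0 < p)
    (i : Coord r) (F : Cone r → ℂ) (hF : Measurable F) {C : ℝ} (hC : ∀ z, ‖F z‖ ≤ C)
    (hinv : ∀ t : ℂ, t ≠ 0 → ∀ z, F (act a r t z) = F z) :
    Integrable (fun w => homDensity a r p (slice i w) • F (slice i w)) ∧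
    Integrable (fun x => dirichletDensity r x.1 • F (scaledPoint a r p x.1 x.2))
      ((simplexMeasure m).prod (spheresMeasure r)) ∧
    ∫ w, homDensity a r p (slice i w) • F (slice i w) =
      (p / (Real.pi * a i.1) * polarConst a r p) •
        ∫ x, dirichletDensity r x.1 • F (scaledPoint a r p x.1 x.2)
          ∂(simplexMeasure m).prod (spheresMeasure r) := by
  have hprob := isProbabilityMeasure_spheresMeasure hr
  have hsf := sFinite_spheresMeasure hr
  have hai : (0 : ℝ) < a i.1 := by exact_mod_cast ha i.1
  have hpi := Real.pi_pos
  have hpc := polarConst_pos (r := r) ha hp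
  have hdm := measurable_dirichletDensity (r := r)
  have hsm := (continuous_slice i).measurable
  have hQm := measurable_homDensity (a := a) (r := r) (p := p)
  have hsp := measurable_scaledPoint (a := a) (r := r) (p := p)
  set ν := ((simplexMeasure m).prod (spheresMeasure r)).withDensity
    fun x => ENNReal.ofReal (dirichletDensity r x.1) with hν
  set μ := (volume : Measure (i.Rest → ℂ)).withDensity
    fun w => ENNReal.ofReal (homDensity a r p (slice i w)) with hμ
  have hfin : IsFiniteMeasure ν := by
    refine ⟨?_⟩
    rw [hν, withDensity_apply _ MeasurableSet.univ, Measure.restrict_univ,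
      lintegral_prod _ (by fun_prop)]
    simp only [lintegral_const, measure_univ, mul_one]
    rw [lintegral_dirichletDensity hr]
    exact ENNReal.ofReal_lt_top
  have hmap : μ.map (fun w => F (slice i w)) =
      ENNReal.ofReal (p / (Real.pi * a i.1) * polarConst a r p) •
        ν.map (fun x => F (scaledPoint a r p x.1 x.2)) := by
    refine Measure.ext_of_lintegral _ fun K hK => ?_
    have hFs : Measurable fun w => F (slice i w) := hF.comp hsm
    have hFp : Measurable fun x : (Fin (m + 1) → ℝ) × ((s : Fin (m + 1)) → Sph (r s)) =>
      F (scaledPoint a r p x.1 x.2) := hF.comp hsp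
    rw [lintegral_smul_measure, lintegral_map hK hFs, lintegral_map hK hFp, hμ, hν,
      lintegral_withDensity_eq_lintegral_mul _ (by fun_prop) (by fun_prop),
      lintegral_withDensity_eq_lintegral_mul _ (by fun_prop) (by fun_prop), smul_eq_mul]
    have := lintegral_slice_eq_simplex ha hr hp i (fun z => K (F z)) (by fun_prop)
      fun t ht z => by rw [hinv t ht]
    simpa only [Pi.mul_apply, mul_comm] using this
  obtain ⟨h1, h2⟩ := integral_eq_of_map_eq (hF.comp hsm) (hF.comp hsp) (fun y => hC _)
    ENNReal.ofReal_ne_top hmap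
  have h3 : Integrable (fun x => F (scaledPoint a r p x.1 x.2)) ν :=
    Integrable.of_bound (hF.comp hsp).aestronglyMeasurable C (Eventually.of_forall fun _ => hC _)
  have hQt : ∀ w : i.Rest → ℂ, (ENNReal.ofReal (homDensity a r p (slice i w))).toReal =
      homDensity a r p (slice i w) := fun w => ENNReal.toReal_ofReal (homDensity_nonneg _)
  have hDt : ∀ᵐ x ∂(simplexMeasure m).prod (spheresMeasure r),
      (ENNReal.ofReal (dirichletDensity r x.1)).toReal • F (scaledPoint a r p x.1 x.2) =
      dirichletDensity r x.1 • F (scaledPoint a r p x.1 x.2) := by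
    filter_upwards [Measure.quasiMeasurePreserving_fst.ae (ae_simplexMeasure_pos m)] with x hx
    rw [ENNReal.toReal_ofReal (r := dirichletDensity r x.1) (Finset.prod_nonneg fun s _ => pow_nonneg (hx s).le _)]
  rw [hμ, integrable_withDensity_iff_integrable_smul' (by fun_prop) (by simp)] at h1
  rw [hν, integrable_withDensity_iff_integrable_smul' (by fun_prop) (by simp)] at h3
  rw [hμ, hν, integral_withDensity_eq_integral_toReal_smul (by fun_prop) (by simp),
    integral_withDensity_eq_integral_toReal_smul (by fun_prop) (by simp),
    ENNReal.toReal_ofReal (by positivity)] at h2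
  simp only [Function.comp_apply, hQt] at h1 h2
  rw [integral_congr_ae hDt] at h2
  exact ⟨h1, h3.congr hDt, h2⟩

end Comparison

/-! ### Generic points, multiplicity of the charts and chart constants -/

section Charts

variable {m : ℕ} {a r : Fin (m + 1) → ℕ} {p : ℝ}

/-- The points with all blocks `z_s` nonzero. -/
def genericSet (r : Fin (m + 1) → ℕ) : Set (Cone r) := {z | ∀ s, z s ≠ 0}

theorem isOpen_genericSet : IsOpen (genericSet r) := by
  simp only [genericSet, Set.ofPred_forall]
  exact isOpen_iInter_of_finite fun s => isOpen_ne.preimage (continuous_apply s)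

theorem ne_zero_of_mem_genericSet {z : Cone r} (hz : z ∈ genericSet r) : z ≠ 0 := by
  rintro rfl
  exact hz 0 rfl

theorem act_mem_genericSet {t : ℂ} (ht : t ≠ 0) (z : Cone r) :
    act a r t z ∈ genericSet r ↔ z ∈ genericSet r := by
  simp [genericSet, act, ht]

theorem proj_notMem_hyperplaneSection {z : Cone r} (hz : z ∈ genericSet r) :
    proj a r ⟨z, ne_zero_of_mem_genericSet hz⟩ ∈ (⋃ s, hyperplaneSection a r s)ᶜ := by
  simp only [Set.mem_compl_iff, Set.mem_iUnion, not_exists]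
  rintro s ⟨z', hz', h⟩
  obtain ⟨t, ht, h⟩ := Quotient.exact h
  have h1 : z = act a r t z'.1 := h
  apply hz s
  rw [h1, act, show z'.1 s = 0 from hz', smul_zero]

theorem continuousOn_coneFun {f : P a r → ℂ}
    (hf : ContinuousOn f (⋃ s, hyperplaneSection a r s)ᶜ) :
    ContinuousOn (coneFun f) (genericSet r) := by
  rw [continuousOn_iff_continuous_domRestrict]
  have h1 : (genericSet r).domRestrict (coneFun f) =
      fun z => f (proj a r ⟨z.1, ne_zero_of_mem_genericSet z.2⟩) := by
    funext z
    exact dif_pos (ne_zero_of_mem_genericSet z.2)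
  rw [h1]
  refine hf.comp_continuous ?_ fun z => proj_notMem_hyperplaneSection z.2
  exact continuous_quotient_mk'.comp (continuous_subtype_val.subtype_mk _)

/-- The invariant function `f` on the generic set, extended by `0`. -/
def genericFun (f : P a r → ℂ) : Cone r → ℂ := (genericSet r).indicator (coneFun f)

/-- Nothing is assumed about the measurability of f on the sections z_s = 0; replacing f by 0 there
gives a Borel function, and only null sets of the integrals are affected. -/
theorem measurable_genericFun {f : P a r → ℂ}
    (hf : ContinuousOn f (⋃ s, hyperplaneSection a r s)ᶜ) : Measurable (genericFun f) := by
  classical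
  have h := (continuousOn_coneFun hf).measurable_piecewise (g := fun _ => (0 : ℂ))
    continuousOn_const isOpen_genericSet.measurableSet
  convert h using 1
  exact (Set.piecewise_eq_indicator).symm

theorem genericFun_of_mem (f : P a r → ℂ) {z : Cone r} (hz : z ∈ genericSet r) :
    genericFun f z = coneFun f z := Set.indicator_of_mem hz _

theorem coneFun_act (f : P a r → ℂ) {t : ℂ} (ht : t ≠ 0) {z : Cone r} (hz : z ∈ genericSet r) :
    coneFun f (act a r t z) = coneFun f z := by
  have hz' := (act_mem_genericSet (a := a) ht z).2 hz
  rw [coneFun, coneFun, dif_pos (ne_zero_of_mem_genericSet hz),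
    dif_pos (ne_zero_of_mem_genericSet hz')]
  congr 1
  exact (Quotient.sound (s := orbitSetoid a r) ⟨t, ht, rfl⟩).symm

theorem genericFun_act (f : P a r → ℂ) {t : ℂ} (ht : t ≠ 0) (z : Cone r) :
    genericFun f (act a r t z) = genericFun f z := by
  by_cases hz : z ∈ genericSet r
  · rw [genericFun_of_mem f hz, genericFun_of_mem f ((act_mem_genericSet ht z).2 hz),
      coneFun_act f ht hz]
  · rw [genericFun, Set.indicator_of_notMem hz,
      Set.indicator_of_notMem (mt (act_mem_genericSet ht z).1 hz)]

theorem norm_genericFun_le {f : P a r → ℂ} {C : ℝ} (hC : ∀ x, ‖f x‖ ≤ C) (z : Cone r) :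
    ‖genericFun f z‖ ≤ |C| := by
  by_cases hz : z ∈ genericSet r
  · rw [genericFun_of_mem f hz, coneFun, dif_pos (ne_zero_of_mem_genericSet hz)]
    exact (hC _).trans (le_abs_self C)
  · rw [genericFun, Set.indicator_of_notMem hz, norm_zero]
    exact abs_nonneg C

theorem ncard_roots_of_one {n : ℕ} (hn : 0 < n) : {t : ℂ | t ^ n = 1}.ncard = n := by
  have h : {t : ℂ | t ^ n = 1} = (Polynomial.nthRootsFinset n (1 : ℂ) : Set ℂ) := by
    ext t
    simp [Polynomial.mem_nthRootsFinset hn]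
  rw [h, Set.ncard_coe_finset]
  exact (Complex.isPrimitiveRoot_exp n hn.ne').card_nthRootsFinset

theorem eq_one_of_forall_pow_eq_one (hgcd : Finset.univ.gcd a = 1) {t : ℂ}
    (h : ∀ s, t ^ a s = 1) : t = 1 := by
  have h1 : orderOf t ∣ Finset.univ.gcd a := Finset.dvd_gcd fun s _ => orderOf_dvd_of_pow_eq_one (h s)
  rw [hgcd, Nat.dvd_one] at h1
  exact orderOf_eq_one_iff.1 h1

theorem slice_pow_smul (i : Coord r) {t : ℂ} (ht : t ^ a i.1 = 1) (w : i.Rest → ℂ) :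
    slice i (fun c => t ^ a c.1.1 * w c) = act a r t (slice i w) := by
  funext s
  ext j
  simp only [slice, act, PiLp.smul_apply, smul_eq_mul]
  split_ifs with h
  · have : s = i.1 := congrArg Sigma.fst h
    have h1 : t ^ a s = 1 := this ▸ ht
    rw [h1, mul_one]
  · rfl

theorem slice_injective (i : Coord r) : Function.Injective (slice i) := by
  intro w w' h
  funext c
  have h1 := congrArg (fun z : Cone r => z c.1.1 c.1.2) h
  simpa [slice, c.2] using h1

/-- The isotropy groups of generic points are trivial, hence the charts are generically
`a_i`-to-one. -/
theorem multiplicity_eq (ha : ∀ s, 0 < a s) (hgcd : Finset.univ.gcd a = 1) (hr : ∀ s, 0 < r s)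
    (i : Coord r) {w : i.Rest → ℂ} (hw : ∀ c, w c ≠ 0) : multiplicity a i w = a i.1 := by
  have h1 : {w' : i.Rest → ℂ | chart a i w' = chart a i w} =
      (fun (t : ℂ) (c : i.Rest) => t ^ a c.1.1 * w c) '' {t : ℂ | t ^ a i.1 = 1} := by
    ext w'
    constructor
    · intro h
      obtain ⟨t, ht, h⟩ := Quotient.exact (Eq.symm h)
      have h2 : slice i w' = act a r t (slice i w) := h
      have h3 : t ^ a i.1 = 1 := by
        have := congrArg (fun z : Cone r => z i.1 i.2) h2
        simpa [act, slice_self] using this.symm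
      exact ⟨t, h3, slice_injective i (by rw [h2]; exact slice_pow_smul i h3 w)⟩
    · rintro ⟨t, ht, rfl⟩
      have ht0 : t ≠ 0 := by
        rintro rfl
        rw [Set.mem_ofPred_eq, zero_pow (ha i.1).ne'] at ht
        exact zero_ne_one ht
      refine (Quotient.sound (s := orbitSetoid a r) ⟨t, ht0, ?_⟩).symm
      exact slice_pow_smul i ht w
  rw [multiplicity, h1, Set.InjOn.ncard_image, ncard_roots_of_one (ha i.1)]
  intro t ht t' ht' h
  have ht0 : t' ≠ 0 := by
    rintro rfl
    rw [Set.mem_ofPred_eq, zero_pow (ha i.1).ne'] at ht'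
    exact zero_ne_one ht'
  rw [← div_eq_one_iff_eq ht0]
  -- For each s, compare t and t' on the first coordinate of the block s. If that coordinate is i
  -- itself, which the slice does not see, then t^{a_i} = 1 = t'^{a_i} is used instead.
  refine eq_one_of_forall_pow_eq_one hgcd fun s => ?_
  rw [div_pow, div_eq_one_iff_eq (pow_ne_zero _ ht0)]
  by_cases hs : (⟨s, ⟨0, hr s⟩⟩ : Coord r) = i
  · have : s = i.1 := congrArg Sigma.fst hs
    rw [this]
    exact Eq.trans ht (Eq.symm ht')
  · exact mul_right_cancel₀ (hw ⟨_, hs⟩) (congrFun h ⟨_, hs⟩)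

theorem card_coord (r : Fin (m + 1) → ℕ) : Fintype.card (Coord r) = ∑ s, r s := by
  simp

theorem chartCount_eq (i : Coord r) {w : i.Rest → ℂ} (hw : ∀ c, w c ≠ 0) :
    chartCount i w = ∑ s, r s := by
  rw [chartCount, Finset.filter_true_of_mem, Finset.card_univ, card_coord]
  intro j _
  by_cases hj : j = i
  · rw [hj, slice_self]; exact one_ne_zero
  · have : slice i w j.1 j.2 = w ⟨j, hj⟩ := by simp [slice, hj]
    rw [this]; exact hw _

theorem slice_mem_genericSet (hr : ∀ s, 0 < r s) (i : Coord r) {w : i.Rest → ℂ}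
    (hw : ∀ c, w c ≠ 0) : slice i w ∈ genericSet r := by
  intro s hs
  have h0 : slice i w s ⟨0, hr s⟩ = 0 := by rw [hs]; rfl
  by_cases hj : (⟨s, ⟨0, hr s⟩⟩ : Coord r) = i
  · simp [slice, hj] at h0
  · have : slice i w s ⟨0, hr s⟩ = w ⟨_, hj⟩ := by simp [slice, hj]
    exact hw _ (this ▸ h0)

theorem ae_forall_ne_zero (J : Type*) [Fintype J] : ∀ᵐ w : J → ℂ, ∀ c, w c ≠ 0 :=
  ae_all_iff.2 fun c => Measure.ae_eval_ne (fun _ => volume) c 0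

theorem prod_radialCoeff_pow (z : Cone r) :
    ∏ s, (radialCoeff a r p z s ^ r s * (p / a s)) =
      (∏ s, (p / a s / (a s : ℝ) ^ r s)) * homDensity a r p z := by
  rw [homDensity, ← Finset.prod_mul_distrib]
  refine Finset.prod_congr rfl fun s _ => ?_
  have : radialCoeff a r p z s =
      ‖z s‖ ^ (2 * p / (a s : ℝ)) / (radialSum a r p z * ‖z s‖ ^ 2) / a s := by
    rw [radialCoeff, div_div]
    congr 1
    ring
  rw [this, div_pow]
  ring

/-- The constant of the `i`-th chart. -/
def chartConst (a r : Fin (m + 1) → ℕ) (p : ℝ) (i : Coord r) : ℝ :=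
  (((∑ s, r s) - 1).factorial : ℝ) * (1 / Real.pi) ^ ((∑ s, r s) - 1) *
    ((a i.1 : ℝ) ^ 2 / p * ∏ s, (p / a s / (a s : ℝ) ^ r s)) /
      ((a i.1 : ℝ) * ((∑ s, r s : ℕ) : ℝ))

/-- Almost every w has no zero coordinate. There the point is generic, the multiplicity is a_i and
all N charts see it, so the denominators are constant. -/
theorem chartIntegrand_ae_eq (ha : ∀ s, 0 < a s) (hgcd : Finset.univ.gcd a = 1)
    (hr : ∀ s, 0 < r s) (hp : 0 < p) (f : P a r → ℂ) (i : Coord r) :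
    chartIntegrand f (kahlerForm a r p) i =ᵐ[volume] fun w =>
      chartConst a r p i • (homDensity a r p (slice i w) • genericFun f (slice i w)) := by
  filter_upwards [ae_forall_ne_zero i.Rest] with w hw
  have hz := slice_mem_genericSet hr i hw
  have hf : f (chart a i w) = genericFun f (slice i w) := by
    rw [genericFun_of_mem f hz, coneFun, dif_pos (slice_ne_zero i w)]
    rfl
  rw [chartIntegrand, multiplicity_eq ha hgcd hr i hw, chartCount_eq i hw,
    wedgePow_chartForm ha hp i w hz, prod_radialCoeff_pow, hf, smul_smul, Complex.real_smul]
  congr 2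
  rw [chartConst]
  ring

/-- The factor a_i² of the minor is cancelled by the multiplicity a_i and by the a_i of the orbit
integral. The powers of p and π cancel too, so every chart gives the same 1/N share. -/
theorem chartConst_mul (ha : ∀ s, 0 < a s) (hr : ∀ s, 0 < r s) (hp : 0 < p) (i : Coord r) :
    chartConst a r p i * (p / (Real.pi * a i.1) * polarConst a r p) =
      (((∑ s, r s) - 1).factorial : ℝ) / (∏ s, (a s : ℝ) ^ r s) /
        ((∑ s, r s : ℕ) : ℝ) * ∏ s, (1 / ((r s - 1).factorial : ℝ)) := by
  have hai : (0 : ℝ) < a i.1 := by exact_mod_cast ha i.1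
  have hpi := Real.pi_pos
  have hN : 0 < ∑ s, r s := Finset.sum_pos (fun s _ => hr s) Finset.univ_nonempty
  have h1 : polarConst a r p * ∏ s, (p / a s / (a s : ℝ) ^ r s) =
      Real.pi ^ (∑ s, r s) * ((∏ s, (a s : ℝ) ^ r s)⁻¹ * ∏ s, (1 / ((r s - 1).factorial : ℝ))) := by
    rw [polarConst, ← Finset.prod_mul_distrib, ← Finset.prod_pow_eq_pow_sum, ← Finset.prod_inv_distrib,
      ← Finset.prod_mul_distrib, ← Finset.prod_mul_distrib]
    refine Finset.prod_congr rfl fun s _ => ?_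
    have : (0 : ℝ) < a s := by exact_mod_cast ha s
    field_simp
  have h2 : Real.pi ^ (∑ s, r s) = Real.pi ^ ((∑ s, r s) - 1) * Real.pi := by
    rw [← pow_succ]
    congr 1
    omega
  have hN' : (((∑ s, r s : ℕ) : ℝ)) ≠ 0 := by exact_mod_cast hN.ne'
  rw [h2] at h1
  have h3 : chartConst a r p i * (p / (Real.pi * a i.1) * polarConst a r p) =
      (((∑ s, r s) - 1).factorial : ℝ) * (1 / Real.pi) ^ ((∑ s, r s) - 1) *
        (1 / Real.pi) / ((∑ s, r s : ℕ) : ℝ) *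
          (polarConst a r p * ∏ s, (p / a s / (a s : ℝ) ^ r s)) := by
    rw [chartConst]
    generalize (((∑ s, r s) - 1).factorial : ℝ) = F
    generalize ((∑ s, r s : ℕ) : ℝ) = N at *
    field_simp
  rw [h3, h1, one_div_pow]
  generalize (((∑ s, r s) - 1).factorial : ℝ) = F
  generalize ((∑ s, r s : ℕ) : ℝ) = N at *
  field_simp

end Charts

/-! ### Assembly of the formula and the limit p → ∞ -/

section Final

variable {m : ℕ} {a r : Fin (m + 1) → ℕ} {p : ℝ}

theorem scaledPoint_mem_genericSet {x : Fin (m + 1) → ℝ} (hx : ∀ s, 0 < x s)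
    (u : (s : Fin (m + 1)) → Sph (r s)) : scaledPoint a r p x u ∈ genericSet r := fun s =>
  smul_ne_zero (Real.rpow_pos_of_pos (hx s) _).ne' (ne_zero_of_mem_unit_sphere (u s))

theorem simplexIntegrand_ae_eq (hr : ∀ s, 0 < r s) (f : P a r → ℂ) :
    simplexIntegrand f p =ᵐ[(simplexMeasure m).prod (spheresMeasure r)] fun x =>
      (∏ s, (1 / ((r s - 1).factorial : ℝ))) •
        (dirichletDensity r x.1 • genericFun f (scaledPoint a r p x.1 x.2)) := by
  have := sFinite_spheresMeasure hr
  filter_upwards [Measure.quasiMeasurePreserving_fst.ae (ae_simplexMeasure_pos m)] with x hx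
  rw [simplexIntegrand, genericFun_of_mem f (scaledPoint_mem_genericSet hx x.2), smul_smul,
    Complex.real_smul, mul_comm, dirichletDensity, ← Finset.prod_mul_distrib]
  have h : ∀ s, x.1 s ^ (r s - 1) / ((r s - 1).factorial : ℝ) =
      1 / ((r s - 1).factorial : ℝ) * x.1 s ^ (r s - 1) := fun s => by ring
  simp only [h]

/-- The N charts have equal integrals, each containing the factor 1/N, so their sum is the simplex
integral with the stated constant. -/
theorem integrable_and_integral_eq (ha : ∀ s, 0 < a s) (hgcd : Finset.univ.gcd a = 1)
    (hr : ∀ s, 0 < r s) (f : P a r → ℂ) {C : ℝ} (hC : ∀ x, ‖f x‖ ≤ C)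
    (hf : ContinuousOn f (⋃ s, hyperplaneSection a r s)ᶜ) (hp : 0 < p) :
    IntegrableTop f (kahlerForm a r p) ∧
    Integrable (simplexIntegrand f p) ((simplexMeasure m).prod (spheresMeasure r)) ∧
    integralTop f (kahlerForm a r p) =
      (((((∑ s, r s) - 1).factorial : ℝ) / (∏ s, (a s : ℝ) ^ r s) : ℝ) : ℂ) *
        ∫ xu, simplexIntegrand f p xu ∂((simplexMeasure m).prod (spheresMeasure r)) := by
  have key := fun i : Coord r => integral_slice_eq_simplex ha hr hp i (genericFun f)
    (measurable_genericFun hf) (norm_genericFun_le hC) fun t ht z => genericFun_act f ht z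
  have hN : ((∑ s, r s : ℕ) : ℝ) ≠ 0 := by
    exact_mod_cast (Finset.sum_pos (fun s _ => hr s) Finset.univ_nonempty).ne'
  refine ⟨fun i => ((key i).1.smul (chartConst a r p i)).congr (chartIntegrand_ae_eq ha hgcd hr hp f i).symm,
    ((key ⟨0, 0, hr 0⟩).2.1.smul (∏ s, (1 / ((r s - 1).factorial : ℝ)))).congr (simplexIntegrand_ae_eq hr f).symm, ?_⟩
  have h1 : ∀ i : Coord r, ∫ w, chartIntegrand f (kahlerForm a r p) i w =
      ((((∑ s, r s) - 1).factorial : ℝ) / (∏ s, (a s : ℝ) ^ r s) /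
        ((∑ s, r s : ℕ) : ℝ) * ∏ s, (1 / ((r s - 1).factorial : ℝ))) •
        ∫ x, dirichletDensity r x.1 • genericFun f (scaledPoint a r p x.1 x.2)
          ∂(simplexMeasure m).prod (spheresMeasure r) := fun i => by
    rw [integral_congr_ae (chartIntegrand_ae_eq ha hgcd hr hp f i), integral_smul, (key i).2.2,
      smul_smul, chartConst_mul ha hr hp]
  rw [integralTop, Finset.sum_congr rfl fun i _ => h1 i, Finset.sum_const, Finset.card_univ,
    card_coord, ← Nat.cast_smul_eq_nsmul ℝ, smul_smul,
    integral_congr_ae (simplexIntegrand_ae_eq hr f), integral_smul, ← Complex.real_smul, smul_smul]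
  congr 1
  generalize ((∑ s, r s : ℕ) : ℝ) = N at *
  field_simp

theorem integrable_dirichletDensity (hr : ∀ s, 0 < r s) :
    Integrable (dirichletDensity r) (simplexMeasure m) := by
  refine ⟨measurable_dirichletDensity.aestronglyMeasurable, ?_⟩
  rw [hasFiniteIntegral_iff_ofReal, lintegral_dirichletDensity hr]
  · exact ENNReal.ofReal_lt_top
  · filter_upwards [ae_simplexMeasure_pos m] with x hx
    exact Finset.prod_nonneg fun s _ => pow_nonneg (hx s).le _

/-- The Dirichlet integral. -/
theorem integral_dirichletDensity (hr : ∀ s, 0 < r s) :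
    ∫ x, dirichletDensity r x ∂simplexMeasure m =
      (∏ s, ((r s - 1).factorial : ℝ)) / ((∑ s, r s) - 1).factorial := by
  rw [integral_eq_lintegral_of_nonneg_ae _ measurable_dirichletDensity.aestronglyMeasurable,
    lintegral_dirichletDensity hr, ENNReal.toReal_ofReal (by positivity)]
  filter_upwards [ae_simplexMeasure_pos m] with x hx
  exact Finset.prod_nonneg fun s _ => pow_nonneg (hx s).le _

theorem coe_spheres_mem_genericSet (u : (s : Fin (m + 1)) → Sph (r s)) :
    (fun s => (u s : EuclideanSpace ℂ (Fin (r s)))) ∈ genericSet r := fun s =>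
  ne_zero_of_mem_unit_sphere (u s)

theorem tendsto_scaledPoint {x : Fin (m + 1) → ℝ} (hx : ∀ s, 0 < x s)
    (u : (s : Fin (m + 1)) → Sph (r s)) :
    Tendsto (fun p => scaledPoint a r p x u) atTop
      (𝓝 fun s => (u s : EuclideanSpace ℂ (Fin (r s)))) := by
  refine tendsto_pi_nhds.2 fun s => ?_
  have h1 : Tendsto (fun p : ℝ => (a s : ℝ) / (2 * p)) atTop (𝓝 0) :=
    tendsto_const_nhds.div_atTop (tendsto_id.const_mul_atTop two_pos)
  have h2 := ((Real.continuous_const_rpow (hx s).ne').tendsto 0).comp h1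
  rw [Real.rpow_zero] at h2
  simpa [scaledPoint] using h2.smul_const (u s : EuclideanSpace ℂ (Fin (r s)))

/-- Dominated convergence with bound |C| ∏ x_s^{r_s-1}. The limit points have all blocks of norm 1,
so they lie in the open generic set, where f is continuous. The limit integrand splits as a product,
and the Dirichlet integral cancels the factorials (r_s-1)!. -/
theorem tendsto_integral_simplexIntegrand (hr : ∀ s, 0 < r s) (f : P a r → ℂ) {C : ℝ}
    (hC : ∀ x, ‖f x‖ ≤ C) (hf : ContinuousOn f (⋃ s, hyperplaneSection a r s)ᶜ) :
    Tendsto (fun p => ∫ xu, simplexIntegrand f p xu ∂((simplexMeasure m).prod (spheresMeasure r)))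
      atTop (𝓝 ((((1 : ℝ) / ((∑ s, r s) - 1).factorial : ℝ) : ℂ) *
        ∫ u, coneFun f (fun s => (u s : EuclideanSpace ℂ (Fin (r s)))) ∂spheresMeasure r)) := by
  have := isProbabilityMeasure_spheresMeasure hr
  have := sFinite_spheresMeasure hr
  have hdm := measurable_dirichletDensity (r := r)
  have h1 : ∀ p, ∫ xu, simplexIntegrand f p xu ∂((simplexMeasure m).prod (spheresMeasure r)) =
      (∏ s, (1 / ((r s - 1).factorial : ℝ))) •
        ∫ x, dirichletDensity r x.1 • genericFun f (scaledPoint a r p x.1 x.2)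
          ∂(simplexMeasure m).prod (spheresMeasure r) := fun p => by
    rw [integral_congr_ae (simplexIntegrand_ae_eq hr f), integral_smul]
  have h2 : (((1 : ℝ) / ((∑ s, r s) - 1).factorial : ℝ) : ℂ) *
        ∫ u, coneFun f (fun s => (u s : EuclideanSpace ℂ (Fin (r s)))) ∂spheresMeasure r =
      (∏ s, (1 / ((r s - 1).factorial : ℝ))) •
        ∫ x : (Fin (m + 1) → ℝ) × ((s : Fin (m + 1)) → Sph (r s)), dirichletDensity r x.1 •
          coneFun f (fun s => (x.2 s : EuclideanSpace ℂ (Fin (r s))))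
          ∂(simplexMeasure m).prod (spheresMeasure r) := by
    have h3 := integral_prod_smul (μ := simplexMeasure m) (ν := spheresMeasure r)
      (dirichletDensity r) fun u => coneFun f (fun s => (u s : EuclideanSpace ℂ (Fin (r s))))
    rw [h3, integral_dirichletDensity hr, smul_smul, ← Complex.real_smul]
    congr 1
    rw [← mul_div_assoc, ← Finset.prod_mul_distrib]
    congr 1
    refine (Finset.prod_eq_one fun s _ => ?_).symm
    have : (0 : ℝ) < (r s - 1).factorial := by positivity
    field_simp
  simp only [h1]
  rw [h2]
  refine Tendsto.const_smul ?_ _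
  have hpos := (Measure.quasiMeasurePreserving_fst (μ := simplexMeasure m)
    (ν := spheresMeasure r)).ae (ae_simplexMeasure_pos m)
  refine tendsto_integral_filter_of_dominated_convergence
    (fun x => dirichletDensity r x.1 * |C|) ?_ ?_
    (((integrable_dirichletDensity hr).mul_const _).comp_fst _) ?_
  · refine Eventually.of_forall fun p => Measurable.aestronglyMeasurable ?_
    exact (hdm.comp measurable_fst).smul ((measurable_genericFun hf).comp measurable_scaledPoint)
  · refine Eventually.of_forall fun p => ?_
    filter_upwards [hpos] with x hx
    have h0 : 0 ≤ dirichletDensity r x.1 :=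
      Finset.prod_nonneg fun s _ => pow_nonneg (hx s).le _
    rw [norm_smul, Real.norm_of_nonneg h0]
    exact mul_le_mul_of_nonneg_left (norm_genericFun_le hC _) h0
  · filter_upwards [hpos] with x hx
    refine Tendsto.const_smul ?_ _
    have hc : ContinuousAt (coneFun f) (fun s => (x.2 s : EuclideanSpace ℂ (Fin (r s)))) :=
      (continuousOn_coneFun hf).continuousAt
        (isOpen_genericSet.mem_nhds (coe_spheres_mem_genericSet x.2))
    refine (hc.tendsto.comp (tendsto_scaledPoint (a := a) hx x.2)).congr fun p => ?_
    exact (genericFun_of_mem f (scaledPoint_mem_genericSet hx x.2)).symm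

theorem integrable_coneFun_spheres (hr : ∀ s, 0 < r s) (f : P a r → ℂ) {C : ℝ}
    (hC : ∀ x, ‖f x‖ ≤ C) (hf : ContinuousOn f (⋃ s, hyperplaneSection a r s)ᶜ) :
    Integrable (fun u => coneFun f (fun s => (u s : EuclideanSpace ℂ (Fin (r s)))))
      (spheresMeasure r) := by
  have := isProbabilityMeasure_spheresMeasure hr
  have h1 : (fun u : (s : Fin (m + 1)) → Sph (r s) =>
      coneFun f (fun s => (u s : EuclideanSpace ℂ (Fin (r s))))) =
      fun u => genericFun f (fun s => (u s : EuclideanSpace ℂ (Fin (r s)))) :=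
    funext fun u => (genericFun_of_mem f (coe_spheres_mem_genericSet u)).symm
  have h2 : Measurable fun u : (s : Fin (m + 1)) → Sph (r s) =>
      (fun s => (u s : EuclideanSpace ℂ (Fin (r s))) : Cone r) := by fun_prop
  rw [h1]
  exact Integrable.of_bound ((measurable_genericFun hf).comp h2).aestronglyMeasurable |C|
    (Eventually.of_forall fun u => norm_genericFun_le hC _)

end Final
end WPS

end

theorem proposition1p13 {m : ℕ} (a r : Fin (m + 1) → ℕ)
    (ha : ∀ s, 0 < a s) (hgcd : Finset.univ.gcd a = 1) (hr : ∀ s, 0 < r s)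
    (f : WPS.P a r → ℂ) (hbdd : ∃ C : ℝ, ∀ x, ‖f x‖ ≤ C)
    (hcont : ContinuousOn f (⋃ s, WPS.hyperplaneSection a r s)ᶜ) :
    (∀ p : ℝ, 0 < p →
      WPS.IntegrableTop f (WPS.kahlerForm a r p) ∧
      Integrable (WPS.simplexIntegrand f p)
        ((WPS.simplexMeasure m).prod (WPS.spheresMeasure r)) ∧
      WPS.integralTop f (WPS.kahlerForm a r p) =
        (((((∑ s, r s) - 1).factorial : ℝ) / (∏ s, (a s : ℝ) ^ r s) : ℝ) : ℂ) *
          ∫ xu, WPS.simplexIntegrand f p xu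
            ∂((WPS.simplexMeasure m).prod (WPS.spheresMeasure r))) ∧
    Integrable (fun u => WPS.coneFun f (fun s => (u s : EuclideanSpace ℂ (Fin (r s)))))
      (WPS.spheresMeasure r) ∧
    Tendsto (fun p : ℝ => WPS.integralTop f (WPS.kahlerForm a r p)) atTop
      (𝓝 (((1 / (∏ s, (a s : ℝ) ^ r s) : ℝ) : ℂ) *
        ∫ u, WPS.coneFun f (fun s => (u s : EuclideanSpace ℂ (Fin (r s))))
          ∂(WPS.spheresMeasure r))) := by
  obtain ⟨C, hC⟩ := hbdd
  refine ⟨fun p hp => WPS.integrable_and_integral_eq ha hgcd hr f hC hcont hp,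
    WPS.integrable_coneFun_spheres hr f hC hcont, ?_⟩
  have h := (WPS.tendsto_integral_simplexIntegrand hr f hC hcont).const_mul
    (((((∑ s, r s) - 1).factorial : ℝ) / (∏ s, (a s : ℝ) ^ r s) : ℝ) : ℂ)
  rw [← mul_assoc, ← Complex.ofReal_mul] at h
  have h1 : (((∑ s, r s) - 1).factorial : ℝ) / (∏ s, (a s : ℝ) ^ r s) *
      (1 / (((∑ s, r s) - 1).factorial : ℝ)) = 1 / ∏ s, (a s : ℝ) ^ r s := by
    have : (0 : ℝ) < ((∑ s, r s) - 1).factorial := by positivity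
    field_simp
  rw [h1] at h
  -- The integral formula is available only for p > 0, which holds eventually as p → ∞.
  refine h.congr' ?_
  filter_upwards [eventually_gt_atTop 0] with p hp
  exact (WPS.integrable_and_integral_eq ha hgcd hr f hC hcont hp).2.2.symm
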